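/- Let $s>2$, $0<\bar\phi<1$, $c>0$, and let all random variables live on one probability space. For $T\ge 1$ and $\phi\in[-\bar\phi,\bar\phi]$ let $$Y_{t,T}(\phi)=g(t/T)+V_{t,T}(\phi),\qquad V_{t,T}(\phi)=\phi V_{t-1,T}(\phi)+e_{t,T},\qquad 1\le t\le T .$$ Assume the following. (1) Kernel. $K:\mathbb R\to\mathbb R$ is bounded, nonnegative and symmetric; $\int|K|^{q}<\infty$ for some $q>2$; $K(u)=0$ for $|u|>L_1$ for some $L_1\ge 1$; $K$ is Lipschitz on $\mathbb R$; and for every $x\in[0,1]$ the set $\{u\in G_x:K(u)>0\}$ has positive Lebesgue measure, where $G_0=[0,1]$, $G_1=[-1,0]$ and $G_x=[-1,1]$ for $x\in(0,1)$. (2) Trend. $g$ is twice continuously differentiable on $[0,1]$. (3) Errors. For each $T$ the variables $e_{1,T},\dots,e_{T,T}$ are i.i.d. with mean zero, unit variance, and a density $f_T$ with $\int|f_T(u)-f_T(u+a)|\,du\le C|a|$ for all $a\in\mathbb R$; and $\sup_{T}\sup_{1\le t\le T}E|e_{t,T}|^s\le C$. Here $C$ does not depend on $T$. (4) Bandwidth.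 $h=h_T>0$, $h\to0$, $Th\to\infty$, and $\ln T/(T^{\theta}h)\to0$, where for some $\beta>\dfrac{(s-1)(1+2c)+2s-1}{s-2}$, $$\theta=\frac{\beta(s-2)-(s-1)(1+2c)-2s+1}{\beta s+(s-1)+1}.$$ (5) Initial values. For each $T$ and each $\phi\in[-\bar\phi,\bar\phi]$, $V_{0,T}(\phi)$ has mean zero and is independent of $(e_{1,T},\dots,e_{T,T})$. There are random variables $\xi_{0,T}(\phi)\ge0$ such that, almost surely, $$|V_{0,T}(\phi')-V_{0,T}(\phi)|\le\xi_{0,T}(\phi)\,|\phi'-\phi|\quad\text{for all }\phi,\phi'\in[-\bar\phi,\bar\phi]\text{ with }|\phi'-\phi|\le h,$$ and $\sup_T E\big(\sup_{|\phi|\le\bar\phi}|V_{0,T}(\phi)|^s\big)<\infty$, $\sup_T E\big(\sup_{|\phi|\le\bar\phi}|\xi_{0,T}(\phi)|^s\big)<\infty$. With $K_h(u)=K(u/h)/h$, let $\hat g(x)=\hat g_{T,\phi}(x)=(1,0)\,S_{T,x}^{-1}D_{T,x}$ be the local linear estimator, where $$S_{T,x}=\Big[\tfrac1T\sum_{t=1}^TK_h(\tfrac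 tT-x)\Big(\tfrac{t/T-x}{h}\Big)^{i+j}\Big]_{i,j\in\{0,1\}},\qquad D_{T,x}=\Big[\tfrac1T\sum_{t=1}^TY_{t,T}(\phi)K_h(\tfrac tT-x)\Big(\tfrac{t/T-x}{h}\Big)^{i}\Big]_{i\in\{0,1\}} .$$ Then for all large $T$ the matrix $S_{T,x}$ is invertible for every $x\in[0,1]$, and $$\sup_{|\phi|\le\bar\phi}\ \sup_{x\in[0,1]}|\hat g(x)-g(x)|=O(h^2)+O_p\Big(\sqrt{\tfrac{\ln T}{Th}}\Big),$$ that is, for all large $T$ the left side is almost surely finite and equal to $A_T+R_T$ with $A_T$ deterministic, $A_T=O(h^2)$, and $R_T=O_p\big(\sqrt{\ln T/(Th)}\big)$. -/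

import Mathlib

open MeasureTheory ProbabilityTheory Filter Topology Set

/-- Kernel regularity: boundedness, `s`-th power integrability for some `s > 2`, compact support
in `[-L₁, L₁]` with `L₁ ≥ 1`, and global Lipschitz continuity with constant `Λ₁ ≥ 1`. -/
structure KernelRegular (K : ℝ → ℝ) : Prop where
  bounded : ∃ Kbar : ℝ, ∀ u, |K u| ≤ Kbar
  integrable_rpow : ∃ s : ℝ, 2 < s ∧ Integrable (fun u => |K u| ^ s)
  support : ∃ L₁ : ℝ, 1 ≤ L₁ ∧ ∀ u, L₁ < |u| → K u = 0
  lipschitz : ∃ Λ₁ : ℝ, 1 ≤ Λ₁ ∧ ∀ u u', |K u - K u'| ≤ Λ₁ * |u - u'|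

/-- The set `G_x`: `[-1,0]` at `x = 1`, `[0,1]` at `x = 0`, and `[-1,1]` for other `x`. -/
noncomputable def kernelWindow (x : ℝ) : Set ℝ :=
  if x = 1 then Icc (-1) 0 else if x = 0 then Icc 0 1 else Icc (-1) 1

/-- Additional kernel regularity: nonnegativity, symmetry and
`μ {u ∈ G_x : K u > 0} > 0` for all `x ∈ [0,1]`, with `μ` the Lebesgue measure. -/
structure KernelPositive (K : ℝ → ℝ) : Prop where
  nonneg : ∀ u, 0 ≤ K u
  symm : ∀ u, K (-u) = K u
  mass : ∀ x ∈ Icc (0 : ℝ) 1, 0 < volume {u | u ∈ kernelWindow x ∧ 0 < K u}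

/-- The rescaled kernel `K_h(u) = K(u/h)/h`. -/
noncomputable def scaledKernel (K : ℝ → ℝ) (h u : ℝ) : ℝ := K (u / h) / h

/-- The matrix `S_{T,x}` of the local linear estimator, on the design points `t/T`, `1 ≤ t ≤ T`;
its `(i, j)` entry is `T⁻¹ ∑ K_h(t/T - x) ((t/T - x)/h)^(i+j)`. -/
noncomputable def localLinearS (K : ℝ → ℝ) (h : ℝ) (T : ℕ) (x : ℝ) :
    Matrix (Fin 2) (Fin 2) ℝ :=
  Matrix.of fun i j => (1 / (T : ℝ)) * ∑ t ∈ Finset.Icc 1 T,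
    scaledKernel K h ((t : ℝ) / T - x) * (((t : ℝ) / T - x) / h) ^ ((i : ℕ) + (j : ℕ))

/-- The vector `D_{T,x}` of the local linear estimator, for the observations `y 1, …, y T`. -/
noncomputable def localLinearD (K : ℝ → ℝ) (h : ℝ) (T : ℕ) (y : ℕ → ℝ) (x : ℝ) : Fin 2 → ℝ :=
  fun i => (1 / (T : ℝ)) * ∑ t ∈ Finset.Icc 1 T,
    y t * scaledKernel K h ((t : ℝ) / T - x) * (((t : ℝ) / T - x) / h) ^ (i : ℕ)

/-- The local linear estimator: the first entry of `S_{T,x}⁻¹ D_{T,x}`. -/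
noncomputable def localLinearEstimator (K : ℝ → ℝ) (h : ℝ) (T : ℕ) (y : ℕ → ℝ) (x : ℝ) : ℝ :=
  Matrix.mulVec (localLinearS K h T x)⁻¹ (localLinearD K h T y x) 0

/-- The autoregressive recursion `V_t = φ V_{t-1} + e_t` with initial value `v₀`. -/
def arProcess (φ v₀ : ℝ) (e : ℕ → ℝ) : ℕ → ℝ
  | 0 => v₀
  | t + 1 => φ * arProcess φ v₀ e t + e (t + 1)

/-- The observations `Y_{t,T} = g(t/T) + V_{t,T}(φ)`, where `V_{t,T}(φ)` is the autoregression
with coefficient `φ`, initial value `V0 T φ` and errors `e T t`. -/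
noncomputable def observations {Ω : Type*} (g : ℝ → ℝ) (V0 : ℕ → ℝ → Ω → ℝ) (e : ℕ → ℕ → Ω → ℝ)
    (T : ℕ) (φ : ℝ) (ω : Ω) (t : ℕ) : ℝ :=
  g ((t : ℝ) / T) + arProcess φ (V0 T φ ω) (fun k => e T k ω) t

/-- The errors: for each `T ≥ 1`, the variables `e T 1, …, e T T` are i.i.d. with mean zero and
unit variance, with `s`-th absolute moments bounded uniformly in `T`, and with a density
`f` such that `∫ |f(u) - f(u+a)| du ≤ C |a|` for all `a`, where `C` does not depend on `T`. -/
structure ErrorAssumptions {Ω : Type*} [MeasurableSpace Ω] (P : Measure Ω) (s : ℝ)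
    (e : ℕ → ℕ → Ω → ℝ) : Prop where
  measurable : ∀ T, ∀ t ∈ Finset.Icc 1 T, Measurable (e T t)
  indep : ∀ T, iIndepFun (fun (t : Fin T) => e T ((t : ℕ) + 1)) P
  identDistrib : ∀ T, ∀ t ∈ Finset.Icc 1 T, IdentDistrib (e T t) (e T 1) P P
  mean_zero : ∀ T, ∀ t ∈ Finset.Icc 1 T, ∫ ω, e T t ω ∂P = 0
  unit_variance : ∀ T, ∀ t ∈ Finset.Icc 1 T, ∫ ω, (e T t ω) ^ 2 ∂P = 1
  moment : ∃ C : ℝ, ∀ T, ∀ t ∈ Finset.Icc 1 T,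
    ∫⁻ ω, ENNReal.ofReal (|e T t ω| ^ s) ∂P ≤ ENNReal.ofReal C
  density : ∃ C : ℝ, ∀ T, 1 ≤ T → ∃ f : ℝ → ℝ, Measurable f ∧ (∀ u, 0 ≤ f u) ∧
    (∀ t ∈ Finset.Icc 1 T, P.map (e T t) = volume.withDensity (fun u => ENNReal.ofReal (f u))) ∧
    ∀ a : ℝ, ∫ u, |f u - f (u + a)| ≤ C * |a|

/-- The initial values `V_{0,T}(φ)`, `|φ| ≤ φbar`: for each `T ≥ 1` and each `φ`, the variable
`V_{0,T}(φ)` has mean zero and is independent of `(e T 1, …, e T T)`; almost surely the map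
`φ ↦ V_{0,T}(φ)` is Lipschitz at scale `h T` with random coefficient `ξ_{0,T}(φ)`; and the `s`-th
moments of `sup |V_{0,T}(φ)|` and `sup |ξ_{0,T}(φ)|` are bounded uniformly in `T`. (As `s > 2`,
finiteness of the second moments, and hence integrability, is part of this.) -/
structure InitialAssumptions {Ω : Type*} [MeasurableSpace Ω] (P : Measure Ω) (s φbar : ℝ)
    (h : ℕ → ℝ) (e : ℕ → ℕ → Ω → ℝ) (V0 : ℕ → ℝ → Ω → ℝ) : Prop where
  measurable : ∀ T, 1 ≤ T → ∀ φ ∈ Icc (-φbar) φbar, Measurable (V0 T φ)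
  mean_zero : ∀ T, 1 ≤ T → ∀ φ ∈ Icc (-φbar) φbar, ∫ ω, V0 T φ ω ∂P = 0
  indep : ∀ T, 1 ≤ T → ∀ φ ∈ Icc (-φbar) φbar,
    IndepFun (V0 T φ) (fun ω (t : Fin T) => e T ((t : ℕ) + 1) ω) P
  moment : ∃ C : ℝ, ∀ T, 1 ≤ T →
    ∫⁻ ω, ⨆ φ ∈ Icc (-φbar) φbar, ENNReal.ofReal (|V0 T φ ω| ^ s) ∂P ≤ ENNReal.ofReal C
  lipschitz : ∃ ξ : ℕ → ℝ → Ω → ℝ,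
    (∀ T, 1 ≤ T → ∀ φ ∈ Icc (-φbar) φbar, Measurable (ξ T φ) ∧ ∀ ω, 0 ≤ ξ T φ ω) ∧
    (∀ T, 1 ≤ T → ∀ᵐ ω ∂P, ∀ φ ∈ Icc (-φbar) φbar, ∀ φ' ∈ Icc (-φbar) φbar,
      |φ' - φ| ≤ h T → |V0 T φ' ω - V0 T φ ω| ≤ ξ T φ ω * |φ' - φ|) ∧
    ∃ C : ℝ, ∀ T, 1 ≤ T →
      ∫⁻ ω, ⨆ φ ∈ Icc (-φbar) φbar, ENNReal.ofReal (|ξ T φ ω| ^ s) ∂P ≤ ENNReal.ofReal C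

/-- The exponent `θ` of the bandwidth condition, for mixing exponent `β`, moment order `s`,
parameter dimension `m` and expansion constant `c`. -/
noncomputable def bandwidthExponent (β s m c : ℝ) : ℝ :=
  (β * (s - 2) - m * (s - 1) * (1 + 2 * c) - 2 * s + 1) / (β * s + m * (s - 1) + 1)

/-- `R_T = O_p(b_T)`: for every `ε > 0` there is `M` with `P(|R_T| > M b_T) ≤ ε` for all
large `T`. -/
def IsBigOInProbability {Ω : Type*} [MeasurableSpace Ω] (P : Measure Ω)
    (R : ℕ → Ω → ℝ) (b : ℕ → ℝ) : Prop :=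
  ∀ ε : ℝ, 0 < ε → ∃ M : ℝ, 0 < M ∧
    ∀ᶠ T in atTop, P {ω | M * b T < |R T ω|} ≤ ENNReal.ofReal ε

/-!
The local linear estimator is linear in the observations and exact on linear functions. Applied to
the trend it therefore reproduces `g` up to the second-order Taylor remainder, which is `O(h²)` on
the kernel window (`exists_bias_le`); here the design matrices must be uniformly nondegenerate,
which holds because the kernel is bounded below on an interval and each `x` has a full one-sided
window inside the unit interval (`KernelRegular.exists_det_ge`).

What remains is the estimator applied to the autoregression, hence kernel-weighted sums
`∑ w_t(x) V_t(φ)`. Summation by parts gives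
`(1 - φ) ∑ w_t V_t = ∑ w_t e_t + φ (∑ (w_t - w_{t-1}) V_{t-1} + boundary terms)`, and since the
weights are `O(1 / (T h))` with Lipschitz profile, the second part is at most a constant times
`max (|V_0|, |e_1|, …, |e_T|) / (T h)`. So the supremum over `φ` costs nothing
(`IsLipschitzBump.abs_sum_autoregression_le`), and only `sup_x |∑ w_t(x) e_t|` for independent errors is
left.

That supremum is treated by truncating the errors at `τ = T ^ ((1 - θ) / 2)`, a Chernoff bound with
tilt `√(T h log T)` at each point of a grid of size `T ^ 3` (`measure_abs_sum_truncation_ge_le`), and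
the Lipschitz continuity of the weights in between
(`measure_exists_abs_sum_truncation_gt_le`). The level fits on both sides: `θ < 1 - 2 / s` makes
`T / τ ^ s → 0`, so that by Markov's inequality no error and no initial value exceeds `τ`, with
probability tending to one, while the bandwidth condition says precisely that
`τ ^ 2 log T / (T h) → 0`, which is what the Chernoff bound needs and what makes `τ / (T h)`
negligible against `√(log T / (T h))`.

The deterministic part of the decomposition is the supremum of the absolute bias; the supremum of
the whole error differs from it by at most the supremum of the stochastic part.
-/

/-! ### Compactly supported Lipschitz profiles -/

/-- A bounded Lipschitz function on the line that vanishes outside `[-L, L]`. -/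
structure IsLipschitzBump (κ : ℝ → ℝ) (B Λ L : ℝ) : Prop where
  L_nonneg : 0 ≤ L
  bounded : ∀ u, |κ u| ≤ B
  lipschitz : ∀ u v, |κ u - κ v| ≤ Λ * |u - v|
  support : ∀ u, L < |u| → κ u = 0

namespace IsLipschitzBump

variable {κ : ℝ → ℝ} {B Λ L : ℝ}

lemma B_nonneg (H : IsLipschitzBump κ B Λ L) : 0 ≤ B := (abs_nonneg _).trans (H.bounded 0)

lemma Λ_nonneg (H : IsLipschitzBump κ B Λ L) : 0 ≤ Λ := by
  have := (abs_nonneg _).trans (H.lipschitz 1 0)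
  simpa using this

lemma mul_id (H : IsLipschitzBump κ B Λ L) :
    IsLipschitzBump (fun u => κ u * u) (B * L) (Λ * L + B) L where
  L_nonneg := H.L_nonneg
  bounded u := by
    have hB := H.B_nonneg
    rcases le_or_gt |u| L with hu | hu
    · rw [abs_mul]
      exact mul_le_mul (H.bounded u) hu (abs_nonneg _) hB
    · simpa [H.support u hu] using mul_nonneg hB H.L_nonneg
  lipschitz := by
    have key : ∀ u v, |u| ≤ L → |κ u * u - κ v * v| ≤ (Λ * L + B) * |u - v| := by
      intro u v hu
      calc |κ u * u - κ v * v| = |(κ u - κ v) * u + κ v * (u - v)| := by ring_nf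
        _ ≤ |κ u - κ v| * |u| + |κ v| * |u - v| := by
          rw [← abs_mul, ← abs_mul]; exact abs_add_le _ _
        _ ≤ (Λ * |u - v|) * L + B * |u - v| := by
          gcongr
          · exact mul_nonneg H.Λ_nonneg (abs_nonneg _)
          · exact H.lipschitz u v
          · exact H.bounded v
        _ = _ := by ring
    intro u v
    rcases le_or_gt |u| L with hu | hu
    · exact key u v hu
    rcases le_or_gt |v| L with hv | hv
    · rw [abs_sub_comm, abs_sub_comm u]; exact key v u hv
    · simp only [H.support u hu, H.support v hv, zero_mul, sub_zero, abs_zero]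
      exact mul_nonneg (add_nonneg (mul_nonneg H.Λ_nonneg H.L_nonneg) H.B_nonneg) (abs_nonneg _)
  support u hu := by simp [H.support u hu]

end IsLipschitzBump

/-- The profiles `K(u) u ^ j` that occur in the design matrix and in the bias. -/
lemma KernelRegular.exists_isLipschitzBump {K : ℝ → ℝ} (hK : KernelRegular K) (j : ℕ) :
    ∃ B Λ L, IsLipschitzBump (fun u => K u * u ^ j) B Λ L := by
  induction j with
  | zero =>
    obtain ⟨B, hB⟩ := hK.bounded
    obtain ⟨L, hL, hs⟩ := hK.support
    obtain ⟨Λ, -, hl⟩ := hK.lipschitz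
    exact ⟨B, Λ, L, by linarith, by simpa using hB, by simpa using hl,
      fun u hu => by simp [hs u hu]⟩
  | succ j ih =>
    obtain ⟨B, Λ, L, H⟩ := ih
    exact ⟨B * L, Λ * L + B, L, by simpa only [pow_succ, mul_assoc] using H.mul_id⟩

/-! ### Kernel weights on the design points -/

/-- The weight `κ((t/T - x)/h) / (T h)` that the design point `t/T` receives at `x`. -/
noncomputable def designWeight (κ : ℝ → ℝ) (h : ℝ) (T : ℕ) (x : ℝ) (t : ℕ) : ℝ :=
  κ (((t : ℝ) / T - x) / h) / (T * h)

lemma card_window_le {T : ℕ} {h L : ℝ} (hT : 1 ≤ T) (hh : 0 < h) (hL : 0 ≤ L) (x : ℝ) :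
    ((((Finset.Icc 1 T).filter fun t : ℕ => |((t : ℝ) / T - x) / h| ≤ L).card : ℕ) : ℝ)
      ≤ 2 * L * (T * h) + 1 := by
  have hT' : (0 : ℝ) < T := by exact_mod_cast hT
  set a : ℝ := T * (x - L * h)
  set b : ℝ := T * (x + L * h)
  have hab : b - a = 2 * L * (T * h) := by simp only [a, b]; ring
  have hnn : 0 ≤ 2 * L * (T * h) := by positivity
  have hcard : ((Finset.Icc 1 T).filter fun t : ℕ => |((t : ℝ) / T - x) / h| ≤ L).card
      ≤ (Finset.Icc ⌈a⌉ ⌊b⌋).card := by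
    refine Finset.card_le_card_of_injOn (fun t : ℕ => (t : ℤ)) ?_ (by intro i _ j _ hij; simpa using hij)
    intro t ht
    have ht := (Finset.mem_filter.1 (Finset.mem_coe.1 ht)).2
    rw [abs_div, abs_of_pos hh, div_le_iff₀ hh, abs_le] at ht
    have e : (t : ℝ) = T * ((t : ℝ) / T) := by field_simp
    simp only [Finset.coe_Icc, Set.mem_Icc, Int.ceil_le, Int.le_floor]
    constructor
    · push_cast
      rw [e]
      exact mul_le_mul_of_nonneg_left (by linarith [ht.1]) hT'.le
    · push_cast
      rw [e]
      exact mul_le_mul_of_nonneg_left (by linarith [ht.2]) hT'.le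
  refine (Nat.cast_le.2 hcard).trans ?_
  rw [Int.card_Icc]
  rcases le_or_gt (⌊b⌋ + 1 - ⌈a⌉) 0 with hz | hz
  · rw [Int.toNat_of_nonpos hz]; push_cast; linarith
  · have : (((⌊b⌋ + 1 - ⌈a⌉).toNat : ℕ) : ℝ) = ((⌊b⌋ + 1 - ⌈a⌉ : ℤ) : ℝ) := by
      exact_mod_cast congrArg (Int.cast (R := ℝ)) (Int.toNat_of_nonneg hz.le)
    rw [this]; push_cast
    linarith [Int.floor_le b, Int.le_ceil a]

/-- A sum over the design points whose terms are bounded by `M` and vanish outside the window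
`|t/T - x| ≤ L h` has at most of the order `T h` terms. -/
lemma sum_le_of_window {T : ℕ} {h L M : ℝ} (hT : 1 ≤ T) (hh : 0 < h) (hTh : 1 ≤ T * h)
    (hL : 0 ≤ L) (hM : 0 ≤ M) (x : ℝ) (f : ℕ → ℝ) (hf : ∀ t ∈ Finset.Icc 1 T, f t ≤ M)
    (h0 : ∀ t ∈ Finset.Icc 1 T, L < |((t : ℝ) / T - x) / h| → f t = 0) :
    ∑ t ∈ Finset.Icc 1 T, f t ≤ M * ((2 * L + 1) * (T * h)) := by
  classical
  rw [← Finset.sum_filter_add_sum_filter_not _ (fun t : ℕ => |((t : ℝ) / T - x) / h| ≤ L)]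
  have hz : ∑ t ∈ (Finset.Icc 1 T).filter (fun t : ℕ => ¬ |((t : ℝ) / T - x) / h| ≤ L), f t = 0 :=
    Finset.sum_eq_zero fun t ht =>
      h0 t (Finset.mem_filter.1 ht).1 (not_le.1 (Finset.mem_filter.1 ht).2)
  rw [hz, add_zero]
  calc _ ≤ ∑ t ∈ (Finset.Icc 1 T).filter fun t : ℕ => |((t : ℝ) / T - x) / h| ≤ L, M :=
        Finset.sum_le_sum fun t ht => hf t (Finset.mem_filter.1 ht).1
    _ = _ * M := by rw [Finset.sum_const, nsmul_eq_mul]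
    _ ≤ (2 * L * (T * h) + 1) * M := by gcongr; exact card_window_le hT hh hL x
    _ ≤ M * ((2 * L + 1) * (T * h)) := by nlinarith

namespace IsLipschitzBump

variable {κ : ℝ → ℝ} {B Λ L : ℝ} {T : ℕ} {h : ℝ}

lemma abs_designWeight_le (H : IsLipschitzBump κ B Λ L) (hTh : 1 ≤ T * h) (x : ℝ) (t : ℕ) :
    |designWeight κ h T x t| ≤ B / (T * h) := by
  have : (0 : ℝ) < T * h := by linarith
  rw [designWeight, abs_div, abs_of_pos this]
  gcongr
  exact H.bounded _

lemma designWeight_eq_zero (H : IsLipschitzBump κ B Λ L) {x : ℝ} {t : ℕ}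
    (ht : L < |((t : ℝ) / T - x) / h|) : designWeight κ h T x t = 0 := by
  rw [designWeight, H.support _ ht, zero_div]

lemma sum_abs_designWeight_le (H : IsLipschitzBump κ B Λ L) (hT : 1 ≤ T) (hh : 0 < h)
    (hTh : 1 ≤ T * h) (x : ℝ) :
    ∑ t ∈ Finset.Icc 1 T, |designWeight κ h T x t| ≤ B * (2 * L + 1) := by
  have hp : (0 : ℝ) < T * h := by linarith
  refine (sum_le_of_window hT hh hTh H.L_nonneg (div_nonneg H.B_nonneg hp.le) x _
    (fun t _ => H.abs_designWeight_le hTh x t)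
    (fun t _ ht => by rw [H.designWeight_eq_zero ht, abs_zero])).trans (le_of_eq ?_)
  field_simp

lemma sum_sq_designWeight_le (H : IsLipschitzBump κ B Λ L) (hT : 1 ≤ T) (hh : 0 < h)
    (hTh : 1 ≤ T * h) (x : ℝ) :
    ∑ t ∈ Finset.Icc 1 T, designWeight κ h T x t ^ 2 ≤ B ^ 2 * (2 * L + 1) / (T * h) := by
  have hp : (0 : ℝ) < T * h := by linarith
  refine (sum_le_of_window hT hh hTh H.L_nonneg (M := (B / (T * h)) ^ 2) (sq_nonneg _) x _
    (fun t _ => ?_)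
    (fun t _ ht => by rw [H.designWeight_eq_zero ht]; ring)).trans (le_of_eq ?_)
  · rw [← sq_abs]
    exact pow_le_pow_left₀ (abs_nonneg _) (H.abs_designWeight_le hTh x t) 2
  · field_simp

lemma abs_designWeight_sub_le (H : IsLipschitzBump κ B Λ L) (hh : 0 < h)
    (hTh : 1 ≤ T * h) (x x' : ℝ) (t : ℕ) :
    |designWeight κ h T x t - designWeight κ h T x' t| ≤ Λ * (|x - x'| / h) / (T * h) := by
  have hp : (0 : ℝ) < T * h := by linarith
  rw [designWeight, designWeight, ← sub_div, abs_div, abs_of_pos hp]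
  gcongr
  refine (H.lipschitz _ _).trans (le_of_eq ?_)
  rw [← sub_div, abs_div, abs_of_pos hh, sub_sub_sub_cancel_left, abs_sub_comm]

/-- Neighbouring weights differ by `O((T h)⁻²)`, and only `O(T h)` of the differences are nonzero. -/
lemma sum_abs_designWeight_succ_sub_le (H : IsLipschitzBump κ B Λ L) (hT : 1 ≤ T) (hh : 0 < h)
    (hTh : 1 ≤ T * h) (x : ℝ) :
    ∑ t ∈ Finset.Icc 1 T, |designWeight κ h T x t - designWeight κ h T x (t - 1)|
      ≤ Λ * (2 * (L + 1) + 1) / (T * h) := by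
  have hp : (0 : ℝ) < T * h := by linarith
  have hT' : (0 : ℝ) < T := by exact_mod_cast hT
  have hstep : ∀ t ∈ Finset.Icc 1 T, ((t : ℝ) / T - x) / h - (((t - 1 : ℕ) : ℝ) / T - x) / h
      = 1 / (T * h) := by
    intro t ht
    rw [Nat.cast_sub (Finset.mem_Icc.1 ht).1]
    push_cast
    field_simp
    ring
  refine (sum_le_of_window hT hh hTh (L := L + 1) (M := Λ / (T * h) ^ 2)
    (by linarith [H.L_nonneg]) (div_nonneg H.Λ_nonneg (sq_nonneg _)) x _
    (fun t ht => ?_) (fun t ht hL => ?_)).trans (le_of_eq ?_)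
  · rw [designWeight, designWeight, ← sub_div, abs_div, abs_of_pos hp, div_le_iff₀ hp]
    refine (H.lipschitz _ _).trans (le_of_eq ?_)
    rw [hstep t ht, abs_of_pos (by positivity)]
    field_simp
  · have h1 : 1 / (T * h) ≤ 1 := by rw [div_le_one hp]; exact hTh
    have h2 := hstep t ht
    have h3 : L < |(((t - 1 : ℕ) : ℝ) / T - x) / h| := by
      have := abs_sub_abs_le_abs_sub (((t : ℝ) / T - x) / h) ((((t - 1 : ℕ) : ℝ) / T - x) / h)
      rw [h2, abs_of_pos (by positivity : 0 < 1 / (T * h))] at this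
      linarith
    rw [H.designWeight_eq_zero (by linarith), H.designWeight_eq_zero h3, sub_zero, abs_zero]
  · field_simp

end IsLipschitzBump

/-! ### The autoregression under kernel weights -/

lemma abs_autoregression_le {φ φbar v m : ℝ} {T : ℕ} (e : ℕ → ℝ) (hφ : |φ| ≤ φbar) (h1 : φbar < 1)
    (hm : 0 ≤ m) (he : ∀ t ∈ Finset.Icc 1 T, |e t| ≤ m) {t : ℕ} (ht : t ≤ T) :
    |(arProcess φ v e t)| ≤ |v| + m / (1 - φbar) := by
  have hd : 0 < 1 - φbar := by linarith
  have h0 : 0 ≤ φbar := (abs_nonneg _).trans hφ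
  induction t with
  | zero => simpa [arProcess] using div_nonneg hm hd.le
  | succ t ih =>
    have ih := ih (by omega)
    have h2 := he (t + 1) (Finset.mem_Icc.2 ⟨by omega, ht⟩)
    calc |(arProcess φ v e (t + 1))| ≤ |φ| * |(arProcess φ v e t)| + |e (t + 1)| := by
          rw [arProcess, ← abs_mul]; exact abs_add_le _ _
      _ ≤ φbar * (|v| + m / (1 - φbar)) + m := by gcongr
      _ ≤ |v| + m / (1 - φbar) := by
        have : m = (1 - φbar) * (m / (1 - φbar)) := by field_simp
        nlinarith [abs_nonneg v]

/-- Summation by parts turns a weighted sum of the autoregression into the same weighted sum of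
its errors, up to terms that only involve the increments of the weights. -/
lemma one_sub_mul_sum_autoregression (φ v : ℝ) (e w : ℕ → ℝ) (T : ℕ) :
    (1 - φ) * ∑ t ∈ Finset.Icc 1 T, w t * arProcess φ v e t =
      ∑ t ∈ Finset.Icc 1 T, w t * e t +
      φ * (∑ t ∈ Finset.Icc 1 T, (w t - w (t - 1)) * arProcess φ v e (t - 1)
        + w 0 * v - w T * arProcess φ v e T) := by
  induction T with
  | zero => simp [arProcess]
  | succ T ih =>
    simp only [Finset.sum_Icc_succ_top (Nat.le_add_left 1 T), mul_add, ih, Nat.add_sub_cancel]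
    rw [arProcess]
    ring

/-- A kernel-weighted sum of the autoregression is bounded, uniformly in the autoregressive
coefficient, by the same weighted sum of the errors and a remainder of order `(T h)⁻¹`. -/
lemma IsLipschitzBump.abs_sum_autoregression_le {κ : ℝ → ℝ} {B Λ L : ℝ} (H : IsLipschitzBump κ B Λ L)
    {T : ℕ} {h : ℝ} (hT : 1 ≤ T) (hh : 0 < h) (hTh : 1 ≤ T * h) {φ φbar v m : ℝ} (e : ℕ → ℝ)
    (hφ : |φ| ≤ φbar) (h1 : φbar < 1) (hm : 0 ≤ m) (he : ∀ t ∈ Finset.Icc 1 T, |e t| ≤ m)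
    (hv : |v| ≤ m) (x : ℝ) :
    |∑ t ∈ Finset.Icc 1 T, designWeight κ h T x t * arProcess φ v e t| ≤
      (1 - φbar)⁻¹ * (|∑ t ∈ Finset.Icc 1 T, designWeight κ h T x t * e t| +
        (Λ * (2 * (L + 1) + 1) + 2 * B) * (1 + (1 - φbar)⁻¹) * (m / (T * h))) := by
  have hd : 0 < 1 - φbar := by linarith
  have h0 : 0 ≤ φbar := (abs_nonneg _).trans hφ
  have hp : (0 : ℝ) < T * h := by linarith
  set w := designWeight κ h T x
  set V := m * (1 + (1 - φbar)⁻¹) with hV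
  have hV0 : 0 ≤ V := by positivity
  have hVb : ∀ t ≤ T, |(arProcess φ v e t)| ≤ V := fun t ht =>
    (abs_autoregression_le e hφ h1 hm he ht).trans (by rw [hV, div_eq_mul_inv, mul_add, mul_one]; gcongr)
  have e1 := one_sub_mul_sum_autoregression φ v e w T
  have hw : ∀ t, |w t| ≤ B / (T * h) := fun t => H.abs_designWeight_le hTh x t
  have i1 : |∑ t ∈ Finset.Icc 1 T, (w t - w (t - 1)) * arProcess φ v e (t - 1)|
      ≤ Λ * (2 * (L + 1) + 1) / (T * h) * V := by
    refine (Finset.abs_sum_le_sum_abs _ _).trans ?_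
    calc _ ≤ ∑ t ∈ Finset.Icc 1 T, |w t - w (t - 1)| * V := by
          refine Finset.sum_le_sum fun t ht => ?_
          rw [abs_mul]
          gcongr
          exact hVb _ ((Nat.sub_le _ _).trans (Finset.mem_Icc.1 ht).2)
      _ ≤ _ := by
          rw [← Finset.sum_mul]
          gcongr
          exact H.sum_abs_designWeight_succ_sub_le hT hh hTh x
  have i2 : |w 0 * v| ≤ B / (T * h) * V := by
    rw [abs_mul]
    have : |v| ≤ V := hVb 0 (Nat.zero_le _)
    exact mul_le_mul (hw 0) this (abs_nonneg _) (div_nonneg H.B_nonneg hp.le)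
  have i3 : |w T * arProcess φ v e T| ≤ B / (T * h) * V := by
    rw [abs_mul]
    exact mul_le_mul (hw T) (hVb T le_rfl) (abs_nonneg _) (div_nonneg H.B_nonneg hp.le)
  rw [inv_mul_eq_div, le_div_iff₀ hd, mul_comm]
  set Z := ∑ t ∈ Finset.Icc 1 T, w t * arProcess φ v e t
  set X := ∑ t ∈ Finset.Icc 1 T, w t * e t
  set Y := ∑ t ∈ Finset.Icc 1 T, (w t - w (t - 1)) * arProcess φ v e (t - 1)
  calc (1 - φbar) * |Z| ≤ |1 - φ| * |Z| := by
        gcongr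
        exact le_trans (by linarith [le_abs_self φ]) (le_abs_self _)
    _ = |X + φ * (Y + w 0 * v - w T * arProcess φ v e T)| := by rw [← abs_mul, e1]
    _ ≤ |X| + |φ| * |Y + w 0 * v - w T * arProcess φ v e T| := by
        rw [← abs_mul]; exact abs_add_le _ _
    _ ≤ |X| + 1 * (Λ * (2 * (L + 1) + 1) / (T * h) * V + B / (T * h) * V + B / (T * h) * V) := by
        gcongr
        · linarith
        · refine (abs_sub _ _).trans (add_le_add ((abs_add_le _ _).trans (add_le_add i1 i2)) i3)
    _ = _ := by rw [hV]; ring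

/-! ### The local linear estimator and its design matrix -/

lemma localLinearS_apply (K : ℝ → ℝ) (h : ℝ) (T : ℕ) (x : ℝ) (i j : Fin 2) :
    localLinearS K h T x i j =
      ∑ t ∈ Finset.Icc 1 T, designWeight (fun u => K u * u ^ ((i : ℕ) + (j : ℕ))) h T x t := by
  simp only [localLinearS, Matrix.of_apply, scaledKernel, designWeight, Finset.mul_sum]
  exact Finset.sum_congr rfl fun t _ => by
    rw [mul_comm (T : ℝ) h, ← div_div]; ring

lemma localLinearD_apply (K : ℝ → ℝ) (h : ℝ) (T : ℕ) (y : ℕ → ℝ) (x : ℝ) (i : Fin 2) :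
    localLinearD K h T y x i =
      ∑ t ∈ Finset.Icc 1 T, designWeight (fun u => K u * u ^ (i : ℕ)) h T x t * y t := by
  simp only [localLinearD, scaledKernel, designWeight, Finset.mul_sum]
  exact Finset.sum_congr rfl fun t _ => by
    rw [mul_comm (T : ℝ) h, ← div_div]; ring

lemma localLinearEstimator_add (K : ℝ → ℝ) (h : ℝ) (T : ℕ) (y z : ℕ → ℝ) (x : ℝ) :
    localLinearEstimator K h T (fun t => y t + z t) x =
      localLinearEstimator K h T y x + localLinearEstimator K h T z x := by
  have : localLinearD K h T (fun t => y t + z t) x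
      = localLinearD K h T y x + localLinearD K h T z x := by
    ext i
    simp only [localLinearD_apply, Pi.add_apply, mul_add, Finset.sum_add_distrib]
  rw [localLinearEstimator, this, Matrix.mulVec_add]
  rfl

/-- The estimator is exact on linear functions. -/
lemma localLinearEstimator_linear {K : ℝ → ℝ} {h : ℝ} {T : ℕ} {x : ℝ} (hh : h ≠ 0)
    (hdet : IsUnit (localLinearS K h T x).det) (a b : ℝ) :
    localLinearEstimator K h T (fun t => a + b * ((t : ℝ) / T - x)) x = a := by
  have : localLinearD K h T (fun t => a + b * ((t : ℝ) / T - x)) x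
      = Matrix.mulVec (localLinearS K h T x) ![a, b * h] := by
    ext i
    simp only [localLinearD, Matrix.mulVec, dotProduct, Fin.sum_univ_two, localLinearS,
      Matrix.of_apply, Matrix.cons_val_zero, Matrix.cons_val_one, Finset.mul_sum, Finset.sum_mul,
      ← Finset.sum_add_distrib]
    refine Finset.sum_congr rfl fun t _ => ?_
    simp only [Fin.val_zero, Fin.val_one, add_zero, pow_succ]
    field_simp
  rw [localLinearEstimator, this, Matrix.mulVec_mulVec, Matrix.nonsing_inv_mul _ hdet,
    Matrix.one_mulVec]
  rfl

lemma abs_localLinearEstimator_le {K : ℝ → ℝ} {h : ℝ} {T : ℕ} {x c M : ℝ} (y : ℕ → ℝ)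
    (hc : 0 < c) (hdet : c ≤ (localLinearS K h T x).det)
    (hS : ∀ i j, |localLinearS K h T x i j| ≤ M) :
    |localLinearEstimator K h T y x| ≤
      M / c * (|localLinearD K h T y x 0| + |localLinearD K h T y x 1|) := by
  have hd : 0 < (localLinearS K h T x).det := hc.trans_le hdet
  have hM : 0 ≤ M := (abs_nonneg _).trans (hS 0 0)
  have e : localLinearEstimator K h T y x = (localLinearS K h T x).det⁻¹ *
      (localLinearS K h T x 1 1 * localLinearD K h T y x 0
        - localLinearS K h T x 0 1 * localLinearD K h T y x 1) := by
    rw [localLinearEstimator, Matrix.inv_def, Matrix.adjugate_fin_two, Ring.inverse_eq_inv']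
    simp [Matrix.mulVec, dotProduct, Fin.sum_univ_two]
    ring
  rw [e, abs_mul, abs_inv, abs_of_pos hd, div_eq_inv_mul, mul_assoc]
  gcongr
  refine (abs_sub _ _).trans ?_
  rw [abs_mul, abs_mul, mul_add]
  gcongr
  · exact hS 1 1
  · exact hS 0 1

lemma KernelRegular.exists_abs_localLinearS_le {K : ℝ → ℝ} (hK : KernelRegular K) :
    ∃ M, 0 < M ∧ ∀ (T : ℕ) (h x : ℝ), 1 ≤ T → 0 < h → 1 ≤ T * h →
      ∀ i j, |localLinearS K h T x i j| ≤ M := by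
  choose B Λ L H using hK.exists_isLipschitzBump
  have hnn : ∀ k, 0 ≤ B k * (2 * L k + 1) := fun k =>
    mul_nonneg (H k).B_nonneg (by linarith [(H k).L_nonneg])
  refine ⟨1 + ∑ k ∈ Finset.range 3, B k * (2 * L k + 1),
    by linarith [Finset.sum_nonneg fun k (_ : k ∈ Finset.range 3) => hnn k], ?_⟩
  intro T h x hT hh hTh i j
  rw [localLinearS_apply]
  refine (Finset.abs_sum_le_sum_abs _ _).trans
    (((H (i + j)).sum_abs_designWeight_le hT hh hTh x).trans ?_)
  have := Finset.single_le_sum (fun k _ => hnn k)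
    (Finset.mem_range.2 (by omega : (i : ℕ) + (j : ℕ) < 3))
  linarith

/-- Lower bound for the Gram determinant of `(1, u)` under weights `w`: by Lagrange's identity it
is a sum of nonnegative terms over pairs, and the pairs in `A × A'` contribute. -/
lemma gram_det_ge {ι : Type*} (s A A' : Finset ι) (w u : ι → ℝ) {a δ : ℝ}
    (hw : ∀ i ∈ s, 0 ≤ w i) (hA : A ⊆ s) (hA' : A' ⊆ s) (ha : 0 ≤ a) (hδ : 0 ≤ δ)
    (hwA : ∀ i ∈ A, a ≤ w i) (hwA' : ∀ i ∈ A', a ≤ w i)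
    (hu : ∀ i ∈ A, ∀ j ∈ A', δ ≤ u j - u i) :
    A.card * A'.card * (a ^ 2 * δ ^ 2) / 2 ≤
      (∑ i ∈ s, w i) * (∑ i ∈ s, w i * u i ^ 2) - (∑ i ∈ s, w i * u i) ^ 2 := by
  have id1 : 2 * ((∑ i ∈ s, w i) * (∑ i ∈ s, w i * u i ^ 2) - (∑ i ∈ s, w i * u i) ^ 2)
      = ∑ i ∈ s, ∑ j ∈ s, w i * w j * (u j - u i) ^ 2 := by
    have : ∀ i j, w i * w j * (u j - u i) ^ 2 =
        w i * (w j * u j ^ 2) + (w i * u i ^ 2) * w j - 2 * ((w i * u i) * (w j * u j)) := by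
      intros; ring
    simp only [this, Finset.sum_add_distrib, Finset.sum_sub_distrib, ← Finset.mul_sum,
      ← Finset.sum_mul]
    ring
  have h1 : ∑ i ∈ A, ∑ j ∈ A', (a ^ 2 * δ ^ 2) ≤
      ∑ i ∈ s, ∑ j ∈ s, w i * w j * (u j - u i) ^ 2 := by
    have hn : ∀ i ∈ s, ∀ j ∈ s, 0 ≤ w i * w j * (u j - u i) ^ 2 := fun i hi j hj =>
      mul_nonneg (mul_nonneg (hw i hi) (hw j hj)) (sq_nonneg _)
    refine le_trans (Finset.sum_le_sum fun i hi => ?_)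
      (Finset.sum_le_sum_of_subset_of_nonneg hA fun i hi _ => Finset.sum_nonneg (hn i hi))
    refine le_trans (Finset.sum_le_sum fun j hj => ?_)
      (Finset.sum_le_sum_of_subset_of_nonneg hA' fun j hj _ => hn i (hA hi) j hj)
    rw [sq a]
    have := hwA i hi
    have := hwA' j hj
    have := hu i hi j hj
    gcongr
    · exact mul_nonneg (hw i (hA hi)) (hw j (hA' hj))
    · exact hw i (hA hi)
  simp only [Finset.sum_const, nsmul_eq_mul] at h1
  rw [← id1] at h1
  linarith

/-- The indices `t` counted here are those with `t/T` in the half-open interval `(l, r]`; leaving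
out `l` avoids the index `0`. -/
lemma card_Ioc_floor_ge {T : ℕ} {l r : ℝ} (hl : 0 ≤ l) (hlr : l ≤ r) :
    T * (r - l) - 1 ≤ ((Finset.Ioc ⌊T * l⌋₊ ⌊T * r⌋₊).card : ℝ) := by
  have hle : ⌊T * l⌋₊ ≤ ⌊T * r⌋₊ := Nat.floor_le_floor (by gcongr)
  rw [Nat.card_Ioc, Nat.cast_sub hle]
  have := Nat.floor_le (by positivity : 0 ≤ T * l)
  have := Nat.lt_floor_add_one (T * r)
  linarith

lemma mem_Ioc_floor {T : ℕ} {l r : ℝ} (hT : 1 ≤ T) (hl : 0 ≤ l) (hlr : l ≤ r) (hr : r ≤ 1) {t : ℕ}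
    (ht : t ∈ Finset.Ioc ⌊T * l⌋₊ ⌊T * r⌋₊) :
    t ∈ Finset.Icc 1 T ∧ l ≤ (t : ℝ) / T ∧ (t : ℝ) / T ≤ r := by
  have hT' : (0 : ℝ) < T := by exact_mod_cast hT
  obtain ⟨h1, h2⟩ := Finset.mem_Ioc.1 ht
  have h3 : (t : ℝ) ≤ T * r :=
    (Nat.cast_le.2 h2).trans (Nat.floor_le (mul_nonneg hT'.le (hl.trans hlr)))
  refine ⟨Finset.mem_Icc.2 ⟨by omega, ?_⟩, ?_, ?_⟩
  · have : (t : ℝ) ≤ T := h3.trans (by nlinarith)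
    exact_mod_cast this
  · rw [le_div_iff₀ hT', mul_comm]
    exact ((Nat.floor_lt (mul_nonneg hT'.le hl)).1 h1).le
  · rw [div_le_iff₀ hT', mul_comm]; exact h3

/-- A kernel that charges `[0, 1]` is bounded below on a nondegenerate interval inside it. -/
lemma KernelRegular.exists_interval {K : ℝ → ℝ} (hK : KernelRegular K) (hp : KernelPositive K) :
    ∃ a b κ : ℝ, 0 ≤ a ∧ a < b ∧ b ≤ 1 ∧ 0 < κ ∧ ∀ u ∈ Icc a b, κ ≤ K u := by
  have hm := hp.mass 0 (by simp)
  simp only [kernelWindow, zero_ne_one, if_false, if_true] at hm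
  obtain ⟨Λ, hΛ, hl⟩ := hK.lipschitz
  have : ∃ u ∈ Ioo (0 : ℝ) 1, 0 < K u := by
    by_contra! hcon
    have hsub : {u | u ∈ Icc (0 : ℝ) 1 ∧ 0 < K u} ⊆ {0, 1} := by
      rintro u ⟨hu, hu'⟩
      by_contra hne
      simp only [mem_insert_iff, mem_singleton_iff, not_or] at hne
      exact absurd (hcon u ⟨lt_of_le_of_ne hu.1 (Ne.symm hne.1), lt_of_le_of_ne hu.2 hne.2⟩)
        (not_le.2 hu')
    have h0 : volume ({0, 1} : Set ℝ) = 0 := (Set.toFinite _).measure_zero _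
    exact absurd (measure_mono_null hsub h0) hm.ne'
  obtain ⟨u, hu, hKu⟩ := this
  set r := min (1 - u) (K u / (2 * Λ))
  have hr : 0 < r := lt_min (by linarith [hu.2]) (by positivity)
  refine ⟨u, u + r, K u / 2, hu.1.le, by linarith, ?_, by linarith, ?_⟩
  · linarith [min_le_left (1 - u) (K u / (2 * Λ))]
  · intro v hv
    have h1 := hl u v
    have h2 : |u - v| ≤ K u / (2 * Λ) := by
      rw [abs_sub_comm, abs_of_nonneg (by linarith [hv.1])]
      linarith [hv.2, min_le_right (1 - u) (K u / (2 * Λ))]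
    have h3 : Λ * |u - v| ≤ K u / 2 := by
      calc _ ≤ Λ * (K u / (2 * Λ)) := by gcongr
        _ = _ := by field_simp
    linarith [(abs_le.1 (h1.trans h3)).2]

/-- For large `T h` the design matrices are uniformly nondegenerate: from any `x ∈ [0, 1]`, the
design points fill at least one of the one-sided windows `x + h [0, 1]`, `x - h [0, 1]`, and by
symmetry the kernel charges both. -/
lemma KernelRegular.exists_det_ge {K : ℝ → ℝ} (hK : KernelRegular K) (hp : KernelPositive K) :
    ∃ c N : ℝ, 0 < c ∧ ∀ (T : ℕ) (h x : ℝ), 1 ≤ T → 0 < h → h ≤ 1 / 2 → N ≤ T * h →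
      x ∈ Icc (0 : ℝ) 1 → c ≤ (localLinearS K h T x).det := by
  obtain ⟨a, b, κ, ha, hab, hb, hκ, hKκ⟩ := hK.exists_interval hp
  set d := (b - a) / 3 with hd
  have hd0 : 0 < d := by rw [hd]; linarith
  refine ⟨(d / 2) * (d / 2) * (κ ^ 2 * d ^ 2) / 2, 2 / d, by positivity, ?_⟩
  intro T h x hT hh hh2 hN hx
  have hn : (0 : ℝ) < T * h := lt_of_lt_of_le (by positivity) hN
  have hN' : 1 ≤ T * h * d / 2 := by rw [div_le_iff₀ hd0] at hN; linarith
  -- an interval `[p, p + 3d]` of `u`-values on which `K ≥ κ` and which stays in the design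
  obtain ⟨p, hp0, hp1, hpK⟩ : ∃ p : ℝ, 0 ≤ x + h * p ∧ x + h * (p + 3 * d) ≤ 1 ∧
      ∀ u ∈ Icc p (p + 3 * d), κ ≤ K u := by
    rcases le_total x (1 / 2) with h12 | h12
    · refine ⟨a, by have := hx.1; positivity, ?_, fun u hu => hKκ u ⟨hu.1, ?_⟩⟩
      · have : h * (a + 3 * d) ≤ 1 / 2 * 1 := by
          apply mul_le_mul hh2 <;> linarith
        linarith
      · linarith [hu.2]
    · refine ⟨-b, ?_, ?_, fun u hu => ?_⟩
      · have : h * b ≤ 1 / 2 * 1 := by apply mul_le_mul hh2 <;> linarith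
        linarith
      · have : 0 ≤ h * a := by positivity
        have e : h * (-b + 3 * d) = -(h * a) := by rw [hd]; ring
        rw [e]; linarith [hx.2]
      · rw [← hp.symm]
        exact hKκ (-u) ⟨by linarith [hu.2], by linarith [hu.1]⟩
  set w := designWeight K h T x
  set u : ℕ → ℝ := fun t => ((t : ℝ) / T - x) / h with hu
  have hdet : (localLinearS K h T x).det =
      (∑ t ∈ Finset.Icc 1 T, w t) * (∑ t ∈ Finset.Icc 1 T, w t * u t ^ 2)
        - (∑ t ∈ Finset.Icc 1 T, w t * u t) ^ 2 := by
    rw [Matrix.det_fin_two]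
    simp only [localLinearS_apply, designWeight, Fin.val_zero, Fin.val_one, add_zero, zero_add,
      pow_zero, pow_one, mul_one, w, u, sq, one_add_one_eq_two, div_mul_eq_mul_div]
  set A := Finset.Ioc ⌊T * (x + h * p)⌋₊ ⌊T * (x + h * (p + d))⌋₊ with hA
  set A' := Finset.Ioc ⌊T * (x + h * (p + 2 * d))⌋₊ ⌊T * (x + h * (p + 3 * d))⌋₊ with hA'
  have i1 : h * p ≤ h * (p + d) := by gcongr; linarith
  have i2 : h * (p + d) ≤ h * (p + 2 * d) := by gcongr; linarith
  have i3 : h * (p + 2 * d) ≤ h * (p + 3 * d) := by gcongr; linarith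
  have mA : ∀ t ∈ A, t ∈ Finset.Icc 1 T ∧ p ≤ u t ∧ u t ≤ p + d := by
    intro t ht
    obtain ⟨h1, h2, h3⟩ := mem_Ioc_floor hT hp0 (by linarith) (by linarith) ht
    refine ⟨h1, ?_, ?_⟩
    · rw [hu, le_div_iff₀ hh]; linarith
    · simp only [hu]; rw [div_le_iff₀ hh]; linarith
  have mA' : ∀ t ∈ A', t ∈ Finset.Icc 1 T ∧ p + 2 * d ≤ u t ∧ u t ≤ p + 3 * d := by
    intro t ht
    obtain ⟨h1, h2, h3⟩ := mem_Ioc_floor hT (by linarith) (by linarith) hp1 ht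
    refine ⟨h1, ?_, ?_⟩
    · rw [hu, le_div_iff₀ hh]; linarith
    · simp only [hu]; rw [div_le_iff₀ hh]; linarith
  have cA : T * h * d / 2 ≤ (A.card : ℝ) := by
    refine le_trans ?_ (card_Ioc_floor_ge hp0 (by linarith))
    linarith [show T * (x + h * (p + d) - (x + h * p)) = T * h * d by ring]
  have cA' : T * h * d / 2 ≤ (A'.card : ℝ) := by
    refine le_trans ?_ (card_Ioc_floor_ge (by linarith) (by linarith))
    linarith [show T * (x + h * (p + 3 * d) - (x + h * (p + 2 * d))) = T * h * d by ring]
  have wlow : ∀ t, u t ∈ Icc p (p + 3 * d) → κ / (T * h) ≤ w t := by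
    intro t ht
    simp only [w, designWeight]
    gcongr
    exact hpK _ ht
  have := gram_det_ge (Finset.Icc 1 T) A A' w u (a := κ / (T * h)) (δ := d)
    (fun t _ => div_nonneg (hp.nonneg _) hn.le) (fun t ht => (mA t ht).1)
    (fun t ht => (mA' t ht).1) (by positivity) hd0.le
    (fun t ht => wlow t ⟨(mA t ht).2.1, by linarith [(mA t ht).2.2]⟩)
    (fun t ht => wlow t ⟨by linarith [(mA' t ht).2.1], (mA' t ht).2.2⟩)
    (fun i hi j hj => by linarith [(mA i hi).2.2, (mA' j hj).2.1])
  rw [hdet]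
  refine le_trans ?_ this
  calc d / 2 * (d / 2) * (κ ^ 2 * d ^ 2) / 2
      = (T * h * d / 2) * (T * h * d / 2) * ((κ / (T * h)) ^ 2 * d ^ 2) / 2 := by
        field_simp
    _ ≤ _ := by gcongr

/-! ### The bias -/

lemma exists_taylor_bound {g : ℝ → ℝ} (hg : ContDiffOn ℝ 2 g (Icc 0 1)) :
    ∃ C : ℝ, 0 ≤ C ∧ ∀ x ∈ Icc (0 : ℝ) 1, ∃ b : ℝ, ∀ y ∈ Icc (0 : ℝ) 1,
      |g y - (g x + b * (y - x))| ≤ C * (y - x) ^ 2 := by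
  have hU : UniqueDiffOn ℝ (Icc (0 : ℝ) 1) := uniqueDiffOn_Icc zero_lt_one
  set g' := derivWithin g (Icc (0 : ℝ) 1)
  have hg' : ContDiffOn ℝ 1 g' (Icc 0 1) := hg.derivWithin hU (by norm_num)
  have hd' : DifferentiableOn ℝ g' (Icc 0 1) := hg'.differentiableOn (by norm_num)
  have hd : DifferentiableOn ℝ g (Icc 0 1) := hg.differentiableOn (by norm_num)
  have hc : ContinuousOn (derivWithin g' (Icc (0 : ℝ) 1)) (Icc 0 1) :=
    hg'.continuousOn_derivWithin hU (by norm_num)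
  obtain ⟨C, hC⟩ := isCompact_Icc.exists_bound_of_continuousOn hc
  have hC0 : 0 ≤ C := (norm_nonneg _).trans (hC 0 (by simp))
  refine ⟨C, hC0, fun x hx => ⟨g' x, fun y hy => ?_⟩⟩
  have hlip : ∀ z ∈ Icc (0 : ℝ) 1, |g' z - g' x| ≤ C * |z - x| := fun z hz =>
    (convex_Icc (0 : ℝ) 1).norm_image_sub_le_of_norm_derivWithin_le hd' hC hx hz
  have hsub : uIcc x y ⊆ Icc (0 : ℝ) 1 := by
    rw [← segment_eq_uIcc]; exact (convex_Icc (0 : ℝ) 1).segment_subset hx hy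
  have key := (convex_uIcc x y).norm_image_sub_le_of_norm_hasDerivWithin_le
    (f := fun z => g z - g' x * z) (f' := fun z => g' z - g' x * 1) (C := C * |y - x|)
    (fun z hz => (((hd z (hsub hz)).hasDerivWithinAt).mono hsub).sub
      ((hasDerivWithinAt_id z _).const_mul (g' x)))
    (fun z hz => by
      rw [mul_one]
      refine (hlip z (hsub hz)).trans ?_
      exact mul_le_mul_of_nonneg_left (abs_sub_left_of_mem_uIcc hz) hC0) left_mem_uIcc right_mem_uIcc
  simp only [Real.norm_eq_abs] at key
  calc _ = |g y - g' x * y - (g x - g' x * x)| := by ring_nf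
    _ ≤ _ := key
    _ = _ := by rw [mul_assoc, abs_mul_abs_self, sq]

/-- Exactness on linear functions reduces the bias to the second-order Taylor remainder, which is
`O(h²)` on the window. -/
lemma exists_bias_le {K g : ℝ → ℝ} (hK : KernelRegular K) (hp : KernelPositive K)
    (hg : ContDiffOn ℝ 2 g (Icc 0 1)) :
    ∃ C N : ℝ, 0 ≤ C ∧ ∀ (T : ℕ) (h x : ℝ), 1 ≤ T → 0 < h → h ≤ 1 / 2 → 1 ≤ T * h →
      N ≤ T * h → x ∈ Icc (0 : ℝ) 1 →
      |localLinearEstimator K h T (fun t => g ((t : ℝ) / T)) x - g x| ≤ C * h ^ 2 := by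
  obtain ⟨c, N, hc, hdet⟩ := hK.exists_det_ge hp
  obtain ⟨M, hM, hS⟩ := hK.exists_abs_localLinearS_le
  obtain ⟨C, hC, htay⟩ := exists_taylor_bound hg
  choose B Λ L H using hK.exists_isLipschitzBump
  have hBL : ∀ i, 0 ≤ B i * (2 * L i + 1) := fun i =>
    mul_nonneg (H i).B_nonneg (by linarith [(H i).L_nonneg])
  refine ⟨M / c * (C * (B 2 * (2 * L 2 + 1)) + C * (B 3 * (2 * L 3 + 1))), N, ?_, ?_⟩
  · have := hBL 2
    have := hBL 3
    positivity
  intro T h x hT hh hh2 hTh hN hx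
  have hT' : (0 : ℝ) < T := by exact_mod_cast hT
  have hd := hdet T h x hT hh hh2 hN hx
  obtain ⟨b, hb⟩ := htay x hx
  set r : ℕ → ℝ := fun t => g ((t : ℝ) / T) - (g x + b * ((t : ℝ) / T - x)) with hr
  have e : localLinearEstimator K h T (fun t => g ((t : ℝ) / T)) x - g x
      = localLinearEstimator K h T r x := by
    have := localLinearEstimator_add K h T (fun t => g x + b * ((t : ℝ) / T - x)) r x
    rw [localLinearEstimator_linear hh.ne' (isUnit_iff_ne_zero.2 (hc.trans_le hd).ne')] at this
    simp only [hr, add_sub_cancel] at this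
    rw [this]; simp [hr]
  have hD : ∀ i : Fin 2, |localLinearD K h T r x i| ≤
      C * (B (i + 2) * (2 * L (i + 2) + 1)) * h ^ 2 := by
    intro i
    rw [localLinearD_apply]
    refine (Finset.abs_sum_le_sum_abs _ _).trans ?_
    calc _ ≤ ∑ t ∈ Finset.Icc 1 T,
          |designWeight (fun u => K u * u ^ ((i : ℕ) + 2)) h T x t| * (C * h ^ 2) := by
          refine Finset.sum_le_sum fun t ht => ?_
          obtain ⟨t1, t2⟩ := Finset.mem_Icc.1 ht
          have t2' : (t : ℝ) ≤ T := by exact_mod_cast t2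
          have hr' : |r t| ≤ C * ((t : ℝ) / T - x) ^ 2 :=
            hb _ ⟨by positivity, (div_le_one hT').2 t2'⟩
          rw [abs_mul]
          refine (mul_le_mul_of_nonneg_left hr' (abs_nonneg _)).trans (le_of_eq ?_)
          simp only [designWeight, pow_add _ (i : ℕ), ← mul_assoc, abs_div, abs_mul, abs_pow]
          rw [← sq_abs ((t : ℝ) / T - x), abs_of_pos hh]
          generalize |(t : ℝ) / T - x| = v
          field_simp
      _ ≤ _ := by
          rw [← Finset.sum_mul]
          have := (H (i + 2)).sum_abs_designWeight_le hT hh hTh x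
          calc _ ≤ B (i + 2) * (2 * L (i + 2) + 1) * (C * h ^ 2) := by gcongr
            _ = _ := by ring
  rw [e]
  refine (abs_localLinearEstimator_le r hc hd (hS T h x hT hh hTh)).trans ?_
  have h0 := hD 0
  have h1 := hD 1
  simp only [Fin.val_zero, Fin.val_one, zero_add] at h0 h1
  calc _ ≤ M / c * (C * (B 2 * (2 * L 2 + 1)) * h ^ 2 + C * (B 3 * (2 * L 3 + 1)) * h ^ 2) := by
        gcongr
    _ = _ := by ring

/-! ### Exponential bound for weighted sums of truncated errors -/

lemma integral_exp_le {Ω : Type*} [MeasurableSpace Ω] {P : Measure Ω} [IsProbabilityMeasure P]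
    {X : Ω → ℝ} {τ m r : ℝ} (hX : Measurable X) (hb : ∀ ω, |X ω| ≤ τ) (hm : |∫ ω, X ω ∂P| ≤ m)
    (h2 : ∫ ω, X ω ^ 2 ∂P ≤ 1) (hr : |r| * τ ≤ 1) :
    ∫ ω, Real.exp (r * X ω) ∂P ≤ Real.exp (|r| * m + r ^ 2) := by
  have hi : Integrable X P := Integrable.of_bound hX.aestronglyMeasurable τ
    (Eventually.of_forall fun ω => hb ω)
  have hi2 : Integrable (fun ω => X ω ^ 2) P := Integrable.of_bound
    (hX.pow_const 2).aestronglyMeasurable (τ ^ 2) (Eventually.of_forall fun ω => by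
      rw [Real.norm_eq_abs, abs_pow]; exact pow_le_pow_left₀ (abs_nonneg _) (hb ω) 2)
  have hpt : ∀ ω, Real.exp (r * X ω) ≤ 1 + r * X ω + r ^ 2 * X ω ^ 2 := by
    intro ω
    have h1 : |r * X ω| ≤ 1 := by
      rw [abs_mul]; exact (mul_le_mul_of_nonneg_left (hb ω) (abs_nonneg r)).trans hr
    have := (abs_le.1 (Real.abs_exp_sub_one_sub_id_le h1)).2
    linarith [mul_pow r (X ω) 2]
  calc ∫ ω, Real.exp (r * X ω) ∂P ≤ ∫ ω, (1 + r * X ω + r ^ 2 * X ω ^ 2) ∂P :=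
        integral_mono_of_nonneg (Eventually.of_forall fun ω => (Real.exp_pos _).le)
          (((integrable_const _).add (hi.const_mul r)).add (hi2.const_mul _))
          (Eventually.of_forall hpt)
    _ = 1 + r * ∫ ω, X ω ∂P + r ^ 2 * ∫ ω, X ω ^ 2 ∂P := by
        have i1 : Integrable (fun ω => 1 + r * X ω) P := (integrable_const _).add (hi.const_mul r)
        rw [integral_add i1 (hi2.const_mul _),
          integral_add (integrable_const _) (hi.const_mul r), integral_const_mul,
          integral_const_mul]
        simp
    _ ≤ |r| * m + r ^ 2 + 1 := by
        have a1 : r * ∫ ω, X ω ∂P ≤ |r| * m := (le_abs_self _).trans (by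
          rw [abs_mul]; exact mul_le_mul_of_nonneg_left hm (abs_nonneg r))
        nlinarith [mul_le_mul_of_nonneg_left h2 (sq_nonneg r)]
    _ ≤ _ := Real.add_one_le_exp _

/-- Chernoff bound for a weighted sum of independent bounded variables that are only nearly
centred: the means enter through `m`. -/
lemma measure_weighted_sum_ge_le {Ω ι : Type*} [Fintype ι] [MeasurableSpace Ω] {P : Measure Ω}
    [IsProbabilityMeasure P] {X : ι → Ω → ℝ} {τ m l : ℝ} (k : ι → ℝ) (hind : iIndepFun X P)
    (hX : ∀ i, Measurable (X i)) (hb : ∀ i ω, |X i ω| ≤ τ) (hm : ∀ i, |∫ ω, X i ω ∂P| ≤ m)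
    (h2 : ∀ i, ∫ ω, X i ω ^ 2 ∂P ≤ 1) (hl : 0 ≤ l) (hk : ∀ i, l * |k i| * τ ≤ 1) (a : ℝ) :
    P.real {ω | a ≤ ∑ i, k i * X i ω} ≤
      Real.exp (-l * a + (l * m * ∑ i, |k i| + l ^ 2 * ∑ i, k i ^ 2)) := by
  set Y : ι → Ω → ℝ := fun i ω => k i * X i ω with hY
  have hYm : ∀ i, Measurable (Y i) := fun i => (hX i).const_mul _
  have hYind : iIndepFun Y P := hind.comp (fun i y => k i * y) fun i => measurable_const_mul (k i)
  have hbY : ∀ ω, |∑ i, Y i ω| ≤ ∑ i, |k i| * τ := fun ω =>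
    (Finset.abs_sum_le_sum_abs _ _).trans (Finset.sum_le_sum fun i _ => by
      rw [hY, abs_mul]; exact mul_le_mul_of_nonneg_left (hb i ω) (abs_nonneg _))
  have hSm : Measurable fun ω => ∑ i, Y i ω := Finset.measurable_sum _ fun i _ => hYm i
  have hint : Integrable (fun ω => Real.exp (l * ∑ i, Y i ω)) P :=
    Integrable.of_bound (hSm.const_mul l).exp.aestronglyMeasurable
      (Real.exp (l * ∑ i, |k i| * τ)) (Eventually.of_forall fun ω => by
        rw [Real.norm_eq_abs, Real.abs_exp]
        exact Real.exp_le_exp.2 (mul_le_mul_of_nonneg_left ((le_abs_self _).trans (hbY ω)) hl))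
  have hmgf : mgf (fun ω => ∑ i, Y i ω) P l ≤
      Real.exp (l * m * ∑ i, |k i| + l ^ 2 * ∑ i, k i ^ 2) := by
    have e := hYind.mgf_sum (t := l) hYm Finset.univ
    rw [show (∑ i, Y i) = fun ω => ∑ i, Y i ω by ext; simp] at e
    rw [e, Finset.mul_sum, Finset.mul_sum, ← Finset.sum_add_distrib, Real.exp_sum]
    refine Finset.prod_le_prod (fun i _ => mgf_nonneg) fun i _ => ?_
    have := integral_exp_le (r := l * k i) (hX i) (hb i) (hm i) (h2 i)
      (by rw [abs_mul, abs_of_nonneg hl]; exact hk i)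
    simp only [mgf, hY]
    rw [abs_mul, abs_of_nonneg hl, mul_pow] at this
    calc _ = ∫ ω, Real.exp (l * k i * X i ω) ∂P := by simp only [mul_assoc]
      _ ≤ _ := this
      _ = _ := by ring_nf
  calc _ ≤ Real.exp (-l * a) * mgf (fun ω => ∑ i, Y i ω) P l := measure_ge_le_exp_mul_mgf a hl hint
    _ ≤ _ := by rw [Real.exp_add]; gcongr

lemma measure_abs_weighted_sum_ge_le {Ω ι : Type*} [Fintype ι] [MeasurableSpace Ω] {P : Measure Ω}
    [IsProbabilityMeasure P] {X : ι → Ω → ℝ} {τ m l : ℝ} (k : ι → ℝ) (hind : iIndepFun X P)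
    (hX : ∀ i, Measurable (X i)) (hb : ∀ i ω, |X i ω| ≤ τ) (hm : ∀ i, |∫ ω, X i ω ∂P| ≤ m)
    (h2 : ∀ i, ∫ ω, X i ω ^ 2 ∂P ≤ 1) (hl : 0 ≤ l) (hk : ∀ i, l * |k i| * τ ≤ 1) (a : ℝ) :
    P.real {ω | a ≤ |∑ i, k i * X i ω|} ≤
      2 * Real.exp (-l * a + (l * m * ∑ i, |k i| + l ^ 2 * ∑ i, k i ^ 2)) := by
  have h1 := measure_weighted_sum_ge_le k hind hX hb hm h2 hl hk a
  have h3 := measure_weighted_sum_ge_le (fun i => -k i) hind hX hb hm h2 hl (by simpa using hk) a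
  simp only [abs_neg, neg_sq, neg_mul, Finset.sum_neg_distrib] at h1 h3
  have hsub : {ω | a ≤ |∑ i, k i * X i ω|} ⊆
      {ω | a ≤ ∑ i, k i * X i ω} ∪ {ω | a ≤ -∑ i, k i * X i ω} := fun ω hω =>
    (le_abs.1 hω : a ≤ ∑ i, k i * X i ω ∨ a ≤ -∑ i, k i * X i ω)
  rw [neg_mul]
  linarith [measureReal_mono (μ := P) hsub, measureReal_union_le (μ := P)
    {ω | a ≤ ∑ i, k i * X i ω} {ω | a ≤ -∑ i, k i * X i ω}]

lemma truncation_moments {Ω : Type*} [MeasurableSpace Ω] {P : Measure Ω} [IsProbabilityMeasure P]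
    {X : Ω → ℝ} {s C τ : ℝ} (hX : Measurable X) (hs : 1 < s) (hτ : 0 < τ) (hC : 0 ≤ C)
    (h1 : ∫ ω, X ω ∂P = 0) (h2 : ∫ ω, X ω ^ 2 ∂P = 1)
    (hmom : ∫⁻ ω, ENNReal.ofReal (|X ω| ^ s) ∂P ≤ ENNReal.ofReal C) :
    |∫ ω, truncation X τ ω ∂P| ≤ C * τ ^ (1 - s) ∧ ∫ ω, truncation X τ ω ^ 2 ∂P ≤ 1 := by
  have hi2 : Integrable (fun ω => X ω ^ 2) P := by
    by_contra hcon
    rw [integral_undef hcon] at h2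
    exact zero_ne_one h2
  have hi : Integrable X P :=
    ((memLp_two_iff_integrable_sq hX.aestronglyMeasurable).2 hi2).integrable one_le_two
  have hps : Measurable fun ω => |X ω| ^ s := by fun_prop
  have hnn : 0 ≤ᵐ[P] fun ω => |X ω| ^ s :=
    Eventually.of_forall fun ω => Real.rpow_nonneg (abs_nonneg _) _
  have his : Integrable (fun ω => |X ω| ^ s) P :=
    (lintegral_ofReal_ne_top_iff_integrable hps.aestronglyMeasurable hnn).1
      (hmom.trans_lt ENNReal.ofReal_lt_top).ne
  have hisC : ∫ ω, |X ω| ^ s ∂P ≤ C := by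
    rw [← ofReal_integral_eq_lintegral_ofReal his hnn] at hmom
    exact (ENNReal.ofReal_le_ofReal_iff hC).1 hmom
  have hit : Integrable (truncation X τ) P := hX.aestronglyMeasurable.integrable_truncation
  constructor
  · have hpt : ∀ ω, |truncation X τ ω - X ω| ≤ |X ω| ^ s * τ ^ (1 - s) := by
      intro ω
      rcases lt_or_ge |X ω| τ with hlt | hge
      · rw [truncation_eq_self hlt, sub_self, abs_zero]; positivity
      · have hXp : 0 < |X ω| := hτ.trans_le hge
        have h3 : |truncation X τ ω - X ω| ≤ |X ω| := by
          simp only [truncation, Function.comp, indicator]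
          split_ifs <;> simp
        refine h3.trans ?_
        calc |X ω| = |X ω| ^ s * (|X ω| ^ (s - 1))⁻¹ := by
              rw [← Real.rpow_neg hXp.le, ← Real.rpow_add hXp]; simp
          _ ≤ |X ω| ^ s * (τ ^ (s - 1))⁻¹ := by
              gcongr
          _ = _ := by rw [← Real.rpow_neg hτ.le, neg_sub]
    calc |∫ ω, truncation X τ ω ∂P| = |∫ ω, (truncation X τ ω - X ω) ∂P| := by
          rw [integral_sub hit hi, h1, sub_zero]
      _ ≤ ∫ ω, |truncation X τ ω - X ω| ∂P := abs_integral_le_integral_abs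
      _ ≤ ∫ ω, |X ω| ^ s * τ ^ (1 - s) ∂P :=
          integral_mono (hit.sub hi).abs (his.mul_const _) hpt
      _ ≤ _ := by rw [integral_mul_const]; gcongr
  · rw [← h2]
    refine integral_mono_of_nonneg (Eventually.of_forall fun ω => sq_nonneg _) hi2
      (Eventually.of_forall fun ω => ?_)
    exact sq_le_sq.2 (abs_truncation_le_abs_self X τ ω)

lemma sum_Icc_one_eq_sum_fin (f : ℕ → ℝ) (T : ℕ) :
    ∑ t ∈ Finset.Icc 1 T, f t = ∑ i : Fin T, f ((i : ℕ) + 1) := by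
  rw [Fin.sum_univ_eq_sum_range (fun i => f (i + 1)) T]
  induction T with
  | zero => simp
  | succ n ih => rw [Finset.sum_Icc_succ_top (by omega), ih, Finset.sum_range_succ]

/-- At a fixed point `x`, a kernel-weighted sum of the truncated errors exceeds a multiple `M` of
`√(log T / (T h))` with probability at most `2 T ^ (C' - M)`. -/
lemma measure_abs_sum_truncation_ge_le {Ω : Type*} [MeasurableSpace Ω] {P : Measure Ω}
    [IsProbabilityMeasure P] {s C : ℝ} {e : ℕ → ℕ → Ω → ℝ} (hs : 2 < s) (hC : 0 ≤ C)
    (he : ErrorAssumptions P s e)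
    (hmom : ∀ T, ∀ t ∈ Finset.Icc 1 T,
      ∫⁻ ω, ENNReal.ofReal (|e T t ω| ^ s) ∂P ≤ ENNReal.ofReal C)
    {κ : ℝ → ℝ} {B Λ L : ℝ} (H : IsLipschitzBump κ B Λ L) {T : ℕ} {h τ : ℝ} (hT : 1 ≤ T)
    (hh : 0 < h) (hh1 : h ≤ 1) (hTh : 1 ≤ T * h) (hτ : 1 ≤ τ) (hlog : 1 ≤ Real.log T)
    (hTτ : (T : ℝ) ≤ τ ^ s) (hBτ : B ^ 2 * (τ ^ 2 * Real.log T / (T * h)) ≤ 1) (M x : ℝ) :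
    P.real {ω | M * √(Real.log T / (T * h)) ≤
        |∑ t ∈ Finset.Icc 1 T, designWeight κ h T x t * truncation (e T t) τ ω|} ≤
      2 * Real.exp ((C * (B * (2 * L + 1)) + B ^ 2 * (2 * L + 1) - M) * Real.log T) := by
  have hp : (0 : ℝ) < T * h := by linarith
  have hT' : (0 : ℝ) < T := by exact_mod_cast hT
  have hτ0 : 0 < τ := by linarith
  have hmem : ∀ i : Fin T, (i : ℕ) + 1 ∈ Finset.Icc 1 T := fun i =>
    Finset.mem_Icc.2 ⟨by omega, by omega⟩
  set ℓ := Real.log T with hℓ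
  set n : ℝ := T * h with hn
  have hℓ0 : 0 ≤ ℓ := by linarith
  -- the exponential tilt that balances the linear and the quadratic term
  set l := √(ℓ * n) with hl
  have hlsq : l ^ 2 = ℓ * n := Real.sq_sqrt (by positivity)
  have hlb : l * √(ℓ / n) = ℓ := by
    rw [hl, ← Real.sqrt_mul (by positivity), show ℓ * n * (ℓ / n) = ℓ ^ 2 by field_simp]
    exact Real.sqrt_sq hℓ0
  have hl0 : 0 ≤ l := Real.sqrt_nonneg _
  have hmoms := fun i : Fin T => truncation_moments (P := P) (s := s) (C := C) (τ := τ)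
    (he.measurable T _ (hmem i)) (by linarith) hτ0 hC (he.mean_zero T _ (hmem i))
    (he.unit_variance T _ (hmem i)) (hmom T _ (hmem i))
  have hind : iIndepFun (fun (i : Fin T) => truncation (e T ((i : ℕ) + 1)) τ) P :=
    (he.indep T).comp (fun _ => indicator (Ioc (-τ) τ) id) fun _ =>
      measurable_id.indicator measurableSet_Ioc
  have hk : ∀ t, l * |designWeight κ h T x t| * τ ≤ 1 := by
    intro t
    have h1 : l * |designWeight κ h T x t| * τ ≤ l * (B / n) * τ := by
      gcongr
      exact H.abs_designWeight_le hTh x t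
    refine h1.trans (abs_le_one_iff_mul_self_le_one.2 ?_ |> (le_abs_self _).trans)
    calc _ = l ^ 2 * (B ^ 2 * τ ^ 2) / n ^ 2 := by field_simp
      _ = B ^ 2 * (τ ^ 2 * ℓ / n) := by rw [hlsq]; field_simp
      _ ≤ 1 := hBτ
  -- the truncation bias is negligible because `T ≤ τ ^ s`
  have hlm : l * (C * τ ^ (1 - s)) ≤ C * ℓ := by
    have h1 : l * τ ^ (1 - s) ≤ ℓ := by
      refine abs_le_of_sq_le_sq' ?_ hℓ0 |>.2
      have h2 : (τ ^ (1 - s)) ^ 2 ≤ (T : ℝ)⁻¹ := by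
        rw [← Real.rpow_natCast, ← Real.rpow_mul hτ0.le]
        calc τ ^ ((1 - s) * (2 : ℕ)) ≤ τ ^ (-s) :=
              Real.rpow_le_rpow_of_exponent_le hτ (by push_cast; linarith)
          _ = (τ ^ s)⁻¹ := Real.rpow_neg hτ0.le _
          _ ≤ _ := by gcongr
      calc (l * τ ^ (1 - s)) ^ 2 = ℓ * n * (τ ^ (1 - s)) ^ 2 := by rw [mul_pow, hlsq]
        _ ≤ ℓ * n * (T : ℝ)⁻¹ := by gcongr
        _ = ℓ * h := by rw [hn]; field_simp
        _ ≤ ℓ * ℓ := by gcongr; linarith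
        _ = ℓ ^ 2 := (sq ℓ).symm
    calc _ = C * (l * τ ^ (1 - s)) := by ring
      _ ≤ _ := by gcongr
  have key := measure_abs_weighted_sum_ge_le (P := P) (τ := τ) (l := l)
    (fun i : Fin T => designWeight κ h T x ((i : ℕ) + 1)) hind
    (fun i => (measurable_id.indicator measurableSet_Ioc).comp (he.measurable T _ (hmem i)))
    (fun i ω => (abs_truncation_le_bound _ _ _).trans (abs_of_pos hτ0).le)
    (fun i => (hmoms i).1) (fun i => (hmoms i).2) hl0 (fun i => hk _) (M * √(ℓ / n))
  rw [← sum_Icc_one_eq_sum_fin (fun t => |designWeight κ h T x t|),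
    ← sum_Icc_one_eq_sum_fin (fun t => designWeight κ h T x t ^ 2)] at key
  simp only [sum_Icc_one_eq_sum_fin (fun t => designWeight κ h T x t * truncation (e T t) τ _)]
  refine key.trans ?_
  have hL : 0 ≤ 2 * L + 1 := by linarith [H.L_nonneg]
  gcongr
  calc _ ≤ -l * (M * √(ℓ / n)) + (C * ℓ * (B * (2 * L + 1)) +
        ℓ * n * (B ^ 2 * (2 * L + 1) / n)) := by
        rw [hlsq]
        gcongr
        · exact H.sum_abs_designWeight_le hT hh hTh x
        · exact H.sum_sq_designWeight_le hT hh hTh x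
    _ = -(l * √(ℓ / n)) * M + (C * ℓ * (B * (2 * L + 1)) +
        ℓ * (B ^ 2 * (2 * L + 1))) := by field_simp
    _ = _ := by rw [hlb]; ring

/-! ### Uniformity over the unit interval -/

lemma div_le_sqrt_div {τ ℓ n : ℝ} (hℓ : 1 ≤ ℓ) (hn : 0 < n)
    (h : τ ^ 2 * ℓ / n ≤ 1) : τ / n ≤ √(ℓ / n) := by
  refine Real.le_sqrt_of_sq_le ?_
  rw [div_le_one hn] at h
  rw [div_pow, div_le_div_iff₀ (by positivity) hn]
  have : τ ^ 2 ≤ ℓ * n := by nlinarith [mul_nonneg (sq_nonneg τ) (by linarith : 0 ≤ ℓ - 1)]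
  nlinarith

/-- The bound at fixed points extends to all of `[0, 1]` by a union over the grid `j / T ^ 3`; the
weights are Lipschitz in `x` and the truncated errors bounded, so the grid error is negligible. -/
lemma measure_exists_abs_sum_truncation_gt_le {Ω : Type*} [MeasurableSpace Ω] {P : Measure Ω}
    [IsProbabilityMeasure P] {s C : ℝ} {e : ℕ → ℕ → Ω → ℝ} (hs : 2 < s) (hC : 0 ≤ C)
    (he : ErrorAssumptions P s e)
    (hmom : ∀ T, ∀ t ∈ Finset.Icc 1 T,
      ∫⁻ ω, ENNReal.ofReal (|e T t ω| ^ s) ∂P ≤ ENNReal.ofReal C)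
    {κ : ℝ → ℝ} {B Λ L : ℝ} (H : IsLipschitzBump κ B Λ L) {T : ℕ} {h τ : ℝ} (hT : 1 ≤ T)
    (hh : 0 < h) (hh1 : h ≤ 1) (hTh : 1 ≤ T * h) (hτ : 1 ≤ τ) (hlog : 1 ≤ Real.log T)
    (hTτ : (T : ℝ) ≤ τ ^ s) (hBτ : B ^ 2 * (τ ^ 2 * Real.log T / (T * h)) ≤ 1)
    (h1τ : τ ^ 2 * Real.log T / (T * h) ≤ 1) :
    P {ω | ∃ x ∈ Icc (0 : ℝ) 1,
      (C * (B * (2 * L + 1)) + B ^ 2 * (2 * L + 1) + 5 + Λ) * √(Real.log T / (T * h)) <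
        |∑ t ∈ Finset.Icc 1 T, designWeight κ h T x t * truncation (e T t) τ ω|} ≤
      ENNReal.ofReal (4 / T) := by
  have hp : (0 : ℝ) < T * h := by linarith
  have hT1 : (1 : ℝ) ≤ T := by exact_mod_cast hT
  have hT' : (0 : ℝ) < T := by linarith
  set b := √(Real.log T / (T * h)) with hb
  set M := C * (B * (2 * L + 1)) + B ^ 2 * (2 * L + 1) + 5 with hM
  set S : ℝ → Ω → ℝ := fun x ω =>
    ∑ t ∈ Finset.Icc 1 T, designWeight κ h T x t * truncation (e T t) τ ω with hS
  have hτb : τ / (T * h) ≤ b := div_le_sqrt_div hlog hp h1τ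
  have hgrid : {ω | ∃ x ∈ Icc (0 : ℝ) 1, (M + Λ) * b < |S x ω|} ⊆
      ⋃ j ∈ Finset.range (T ^ 3 + 1), {ω | M * b ≤ |S ((j : ℝ) / (T : ℝ) ^ 3) ω|} := by
    rintro ω ⟨x, hx, hlt⟩
    have hT3 : (0 : ℝ) < (T : ℝ) ^ 3 := by positivity
    set j := ⌊x * (T : ℝ) ^ 3⌋₊
    have hx3 : 0 ≤ x * (T : ℝ) ^ 3 := mul_nonneg hx.1 hT3.le
    have hj : j ≤ T ^ 3 := by
      have : (j : ℝ) ≤ (T : ℝ) ^ 3 := (Nat.floor_le hx3).trans (by nlinarith [hx.2])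
      exact_mod_cast this
    have hxj : |x - (j : ℝ) / (T : ℝ) ^ 3| ≤ 1 / (T : ℝ) ^ 3 := by
      have e1 : x - (j : ℝ) / (T : ℝ) ^ 3 = (x * (T : ℝ) ^ 3 - j) / (T : ℝ) ^ 3 := by field_simp
      rw [e1, abs_div, abs_of_pos hT3, abs_of_nonneg (by linarith [Nat.floor_le hx3])]
      gcongr
      linarith [Nat.lt_floor_add_one (x * (T : ℝ) ^ 3)]
    simp only [mem_iUnion, mem_ofPred_eq, Finset.mem_range]
    refine ⟨j, by omega, ?_⟩
    have hdiff : |S x ω - S ((j : ℝ) / (T : ℝ) ^ 3) ω| ≤ Λ * b := by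
      rw [hS, ← Finset.sum_sub_distrib]
      refine (Finset.abs_sum_le_sum_abs _ _).trans ?_
      calc _ ≤ ∑ t ∈ Finset.Icc 1 T, Λ * (1 / (T : ℝ) ^ 3 / h) / (T * h) * τ := by
            refine Finset.sum_le_sum fun t _ => ?_
            rw [← sub_mul, abs_mul]
            refine mul_le_mul ((H.abs_designWeight_sub_le hh hTh _ _ t).trans ?_)
              ((abs_truncation_le_bound _ _ _).trans (abs_of_pos (by linarith)).le)
              (abs_nonneg _) (div_nonneg (mul_nonneg H.Λ_nonneg (by positivity)) hp.le)
            have := H.Λ_nonneg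
            gcongr
        _ = Λ * (τ / (T * h)) * (1 / (T * (T * h))) := by
            rw [Finset.sum_const, nsmul_eq_mul, Nat.card_Icc, Nat.add_sub_cancel]
            field_simp
        _ ≤ Λ * b * 1 := by
            have := H.Λ_nonneg
            gcongr
            rw [div_le_one (by positivity)]
            nlinarith
        _ = Λ * b := mul_one _
    have := abs_sub_abs_le_abs_sub (S x ω) (S ((j : ℝ) / (T : ℝ) ^ 3) ω)
    linarith [add_mul M Λ b]
  have hpt : ∀ x, P {ω | M * b ≤ |S x ω|} ≤ ENNReal.ofReal (2 * ((T : ℝ) ^ 5)⁻¹) := by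
    intro x
    rw [← ofReal_measureReal]
    refine ENNReal.ofReal_le_ofReal ((measure_abs_sum_truncation_ge_le hs hC he hmom H hT hh hh1
      hTh hτ hlog hTτ hBτ M x).trans (le_of_eq ?_))
    rw [hM, show ∀ p q : ℝ, p + q - (p + q + 5) = -(5 : ℕ) by intros; push_cast; ring,
      neg_mul, Real.exp_neg, Real.exp_nat_mul, Real.exp_log hT']
  refine (measure_mono hgrid).trans ((measure_biUnion_finset_le _ _).trans ?_)
  refine (Finset.sum_le_sum fun j _ => hpt _).trans ?_
  rw [Finset.sum_const, Finset.card_range, nsmul_eq_mul, ← ENNReal.ofReal_natCast,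
    ← ENNReal.ofReal_mul (by positivity)]
  refine ENNReal.ofReal_le_ofReal ?_
  push_cast
  have h3 : (T : ℝ) ^ 3 + 1 ≤ 2 * (T : ℝ) ^ 4 := by
    have a1 : (T : ℝ) ^ 3 ≤ (T : ℝ) ^ 4 := pow_le_pow_right₀ hT1 (by norm_num)
    have a2 : 1 ≤ (T : ℝ) ^ 4 := one_le_pow₀ hT1
    linarith
  calc _ ≤ 2 * (T : ℝ) ^ 4 * (2 * ((T : ℝ) ^ 5)⁻¹) := by gcongr
    _ = 4 / (T : ℝ) := by field_simp; norm_num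

/-! ### Maxima of the errors and of the initial values -/

lemma measure_exists_abs_error_ge_le {Ω : Type*} [MeasurableSpace Ω] {P : Measure Ω}
    {s C τ : ℝ} {T : ℕ} {e : ℕ → Ω → ℝ} (hs : 0 < s) (hτ : 0 < τ)
    (hmeas : ∀ t ∈ Finset.Icc 1 T, Measurable (e t))
    (hmom : ∀ t ∈ Finset.Icc 1 T,
      ∫⁻ ω, ENNReal.ofReal (|e t ω| ^ s) ∂P ≤ ENNReal.ofReal C) :
    P {ω | ∃ t ∈ Finset.Icc 1 T, τ ≤ |e t ω|} ≤ ENNReal.ofReal (C * (T / τ ^ s)) := by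
  have hτs : 0 < τ ^ s := Real.rpow_pos_of_pos hτ s
  have hsub : {ω | ∃ t ∈ Finset.Icc 1 T, τ ≤ |e t ω|} ⊆
      ⋃ t ∈ Finset.Icc 1 T, {ω | ENNReal.ofReal (τ ^ s) ≤ ENNReal.ofReal (|e t ω| ^ s)} := by
    rintro ω ⟨t, ht, hle⟩
    simp only [mem_iUnion, mem_ofPred_eq]
    exact ⟨t, ht, ENNReal.ofReal_le_ofReal (Real.rpow_le_rpow hτ.le hle hs.le)⟩
  refine (measure_mono hsub).trans ((measure_biUnion_finset_le _ _).trans ?_)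
  calc _ ≤ ∑ t ∈ Finset.Icc 1 T, ENNReal.ofReal (C / τ ^ s) := by
        refine Finset.sum_le_sum fun t ht => ?_
        have hm := hmeas t ht
        refine (meas_ge_le_lintegral_div (by fun_prop) (ENNReal.ofReal_pos.2 hτs).ne'
          ENNReal.ofReal_ne_top).trans ?_
        rw [ENNReal.ofReal_div_of_pos hτs]
        gcongr
        exact hmom t ht
    _ = _ := by
        rw [Finset.sum_const, nsmul_eq_mul, Nat.card_Icc, Nat.add_sub_cancel,
          ← ENNReal.ofReal_natCast, ← ENNReal.ofReal_mul (by positivity)]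
        congr 1
        ring

/-- A supremum over a separable index space is a.e. measurable when the paths are a.s. continuous:
almost surely it is a supremum over a countable dense set. -/
lemma aemeasurable_iSup_of_continuous {Ω ι : Type*} [MeasurableSpace Ω] {P : Measure Ω}
    [TopologicalSpace ι] [TopologicalSpace.SeparableSpace ι] {F : ι → Ω → ENNReal}
    (hm : ∀ i, Measurable (F i)) (hc : ∀ᵐ ω ∂P, Continuous fun i => F i ω) :
    AEMeasurable (fun ω => ⨆ i, F i ω) P := by
  obtain ⟨D, hD, hdense⟩ := TopologicalSpace.exists_countable_dense ι
  refine (Measurable.biSup D hD fun i _ => hm i).aemeasurable.congr ?_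
  filter_upwards [hc] with ω hω
  refine le_antisymm (iSup₂_le fun i _ => le_iSup (fun i => F i ω) i) (iSup_le fun i => ?_)
  have hcl : IsClosed {i | F i ω ≤ ⨆ j ∈ D, F j ω} := isClosed_le hω continuous_const
  have hsub : D ⊆ {i | F i ω ≤ ⨆ j ∈ D, F j ω} := fun j hj => le_iSup₂ (f := fun j _ => F j ω) j hj
  exact closure_minimal hsub hcl (hdense i)

lemma continuous_of_local_lipschitz {S : Set ℝ} {f ξ : ℝ → ℝ} {h : ℝ} (hh : 0 < h)
    (hf : ∀ x ∈ S, ∀ y ∈ S, |y - x| ≤ h → |f y - f x| ≤ ξ x * |y - x|) :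
    Continuous fun x : S => f x := by
  rw [continuous_iff_continuousAt]
  intro x
  rw [ContinuousAt, tendsto_iff_dist_tendsto_zero]
  have hlim : Tendsto (fun y : S => ξ x * |(y : ℝ) - x|) (𝓝 x) (𝓝 0) := by
    have : Continuous fun y : S => ξ x * |(y : ℝ) - x| := by fun_prop
    simpa using this.tendsto x
  refine squeeze_zero' (Eventually.of_forall fun _ => dist_nonneg) ?_ hlim
  filter_upwards [Metric.ball_mem_nhds x hh] with y hy
  rw [Real.dist_eq]
  exact hf x x.2 y y.2 (by rw [← Real.dist_eq]; exact (Metric.mem_ball.1 hy).le)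

/-- Markov's inequality for the supremum of the initial values, together with its almost sure
finiteness. The lower Lebesgue integral in the moment assumption is a true one, because the
Lipschitz assumption makes the supremum a.e. measurable. -/
lemma InitialAssumptions.measure_sup {Ω : Type*} [MeasurableSpace Ω] {P : Measure Ω}
    {s φbar C : ℝ} {h : ℕ → ℝ} {e : ℕ → ℕ → Ω → ℝ} {V0 : ℕ → ℝ → Ω → ℝ}
    (hV0 : InitialAssumptions P s φbar h e V0) (hs : 0 < s)
    {T : ℕ} (hT : 1 ≤ T) (hh : 0 < h T)
    (hC : ∫⁻ ω, ⨆ φ ∈ Icc (-φbar) φbar, ENNReal.ofReal (|V0 T φ ω| ^ s) ∂P ≤ ENNReal.ofReal C) :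
    (∀ τ : ℝ, 0 < τ → P {ω | ∃ φ ∈ Icc (-φbar) φbar, τ < |V0 T φ ω|} ≤
      ENNReal.ofReal (C / τ ^ s)) ∧
    ∀ᵐ ω ∂P, ∃ v : ℝ, ∀ φ ∈ Icc (-φbar) φbar, |V0 T φ ω| ≤ v := by
  have hae : AEMeasurable
      (fun ω => ⨆ φ ∈ Icc (-φbar) φbar, ENNReal.ofReal (|V0 T φ ω| ^ s)) P := by
    simp_rw [iSup_subtype']
    refine aemeasurable_iSup_of_continuous (fun φ => ?_) ?_
    · have := hV0.measurable T hT φ φ.2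
      fun_prop
    · obtain ⟨ξ, -, hξ, -⟩ := hV0.lipschitz
      filter_upwards [hξ T hT] with ω hω
      have hc : Continuous fun φ : Icc (-φbar) φbar => V0 T φ ω :=
        continuous_of_local_lipschitz (f := fun φ => V0 T φ ω) (ξ := fun φ => ξ T φ ω) hh hω
      exact ENNReal.continuous_ofReal.comp
        ((hc.abs).rpow_const fun _ => Or.inr hs.le)
  refine ⟨fun τ hτ => ?_, ?_⟩
  · have hτs : 0 < τ ^ s := Real.rpow_pos_of_pos hτ s
    have hsub : {ω | ∃ φ ∈ Icc (-φbar) φbar, τ < |V0 T φ ω|} ⊆ {ω | ENNReal.ofReal (τ ^ s) ≤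
        ⨆ φ ∈ Icc (-φbar) φbar, ENNReal.ofReal (|V0 T φ ω| ^ s)} := by
      rintro ω ⟨φ, hφ, hlt⟩
      exact (ENNReal.ofReal_le_ofReal (Real.rpow_le_rpow hτ.le hlt.le hs.le)).trans
        (le_iSup₂ (f := fun φ _ => ENNReal.ofReal (|V0 T φ ω| ^ s)) φ hφ)
    refine (measure_mono hsub).trans ((meas_ge_le_lintegral_div hae
      (ENNReal.ofReal_pos.2 hτs).ne' ENNReal.ofReal_ne_top).trans ?_)
    rw [ENNReal.ofReal_div_of_pos hτs]
    gcongr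
  · filter_upwards [ae_lt_top' hae (hC.trans_lt ENNReal.ofReal_lt_top).ne] with ω hω
    refine ⟨(⨆ φ ∈ Icc (-φbar) φbar, ENNReal.ofReal (|V0 T φ ω| ^ s)).toReal ^ s⁻¹,
      fun φ hφ => ?_⟩
    have h1 : |V0 T φ ω| ^ s ≤
        (⨆ φ ∈ Icc (-φbar) φbar, ENNReal.ofReal (|V0 T φ ω| ^ s)).toReal := by
      rw [← ENNReal.ofReal_le_iff_le_toReal hω.ne]
      exact le_iSup₂ (f := fun φ _ => ENNReal.ofReal (|V0 T φ ω| ^ s)) φ hφ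
    calc |V0 T φ ω| = (|V0 T φ ω| ^ s) ^ s⁻¹ :=
          (Real.rpow_rpow_inv (abs_nonneg _) hs.ne').symm
      _ ≤ _ := Real.rpow_le_rpow (Real.rpow_nonneg (abs_nonneg _) _) h1 (inv_nonneg.2 hs.le)

/-! ### The bandwidth condition and the truncation level -/

/-- The bandwidth exponent stays strictly below `1 - 2 / s`. -/
lemma one_lt_mul_one_sub_bandwidthExponent {s β c : ℝ} (hs : 2 < s) (hc : 0 < c)
    (hβ : (1 * (s - 1) * (1 + 2 * c) + 2 * s - 1) / (s - 2) < β) :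
    1 < (1 - bandwidthExponent β s 1 c) / 2 * s := by
  have hpos : 0 < 1 * (s - 1) * (1 + 2 * c) + 2 * s - 1 := by nlinarith
  have hβ0 : 0 < β := (div_pos hpos (by linarith)).trans hβ
  have hden : β * s + 1 * (s - 1) + 1 = s * (β + 1) := by ring
  have hb1 : 0 < β + 1 := by linarith
  have hs0 : 0 < s := by linarith
  have e : (1 - bandwidthExponent β s 1 c) / 2 * s = (s - (β * (s - 2) - 1 * (s - 1) * (1 + 2 * c)
      - 2 * s + 1) / (β + 1)) / 2 := by
    rw [bandwidthExponent, hden]; field_simp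
  rw [e, lt_div_iff₀ two_pos, lt_sub_iff_add_lt, ← lt_sub_iff_add_lt', div_lt_iff₀ hb1]
  nlinarith

/-- The level `T ^ ((1 - θ) / 2)` at which the errors are truncated; its square times
`log T / (T h)` is exactly the quantity that the bandwidth condition sends to zero. -/
noncomputable def truncationLevel (β s c : ℝ) (T : ℕ) : ℝ :=
  (T : ℝ) ^ ((1 - bandwidthExponent β s 1 c) / 2)

section truncationLevel

variable {s β c : ℝ} {T : ℕ}

lemma one_le_truncationLevel (hs : 2 < s) (hr : 1 < (1 - bandwidthExponent β s 1 c) / 2 * s)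
    (hT : 1 ≤ T) : 1 ≤ truncationLevel β s c T :=
  Real.one_le_rpow (by exact_mod_cast hT) (by by_contra! hneg; nlinarith)

lemma truncationLevel_rpow (T : ℕ) : truncationLevel β s c T ^ s =
    (T : ℝ) ^ ((1 - bandwidthExponent β s 1 c) / 2 * s) :=
  (Real.rpow_mul (Nat.cast_nonneg T) _ _).symm

lemma le_truncationLevel_rpow (hr : 1 < (1 - bandwidthExponent β s 1 c) / 2 * s) (hT : 1 ≤ T) :
    (T : ℝ) ≤ truncationLevel β s c T ^ s := by
  rw [truncationLevel_rpow]
  exact Real.self_le_rpow_of_one_le (by exact_mod_cast hT) hr.le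

lemma truncationLevel_sq_mul (h : ℝ) (hT : 1 ≤ T) :
    truncationLevel β s c T ^ 2 * Real.log T / (T * h) =
      Real.log T / ((T : ℝ) ^ bandwidthExponent β s 1 c * h) := by
  have hT' : (0 : ℝ) < T := by exact_mod_cast hT
  have e : truncationLevel β s c T ^ 2 = T / (T : ℝ) ^ bandwidthExponent β s 1 c := by
    rw [truncationLevel, ← Real.rpow_natCast, ← Real.rpow_mul hT'.le]
    conv_rhs => rw [← Real.rpow_one (T : ℝ), ← Real.rpow_mul hT'.le, one_mul, ← Real.rpow_sub hT']
    congr 1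
    push_cast
    ring
  rw [e]
  field_simp

lemma tendsto_div_truncationLevel_rpow (hr : 1 < (1 - bandwidthExponent β s 1 c) / 2 * s) :
    Tendsto (fun T : ℕ => (T : ℝ) / truncationLevel β s c T ^ s) atTop (𝓝 0) := by
  have h1 := (tendsto_rpow_neg_atTop (sub_pos.2 hr)).comp tendsto_natCast_atTop_atTop
  refine h1.congr' ?_
  filter_upwards [eventually_ge_atTop 1] with T hT
  have hT' : (0 : ℝ) < T := by exact_mod_cast hT
  rw [truncationLevel_rpow, Function.comp, neg_sub, Real.rpow_sub hT', Real.rpow_one]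

end truncationLevel

/-! ### The supremum of the estimation error -/

/-- A uniform perturbation changes a supremum of absolute values by at most its size. -/
lemma abs_sSup_sub_sSup_le {S X : Set ℝ} {F : ℝ → ℝ → ℝ} {b : ℝ → ℝ} {δ C : ℝ}
    (hS : S.Nonempty) (hX : X.Nonempty) (hb : ∀ x ∈ X, |b x| ≤ C)
    (hF : ∀ φ ∈ S, ∀ x ∈ X, |F φ x - b x| ≤ δ) :
    BddAbove {z : ℝ | ∃ φ ∈ S, ∃ x ∈ X, z = |F φ x|} ∧
    |sSup {z : ℝ | ∃ φ ∈ S, ∃ x ∈ X, z = |F φ x|} - sSup {z : ℝ | ∃ x ∈ X, z = |b x|}| ≤ δ := by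
  obtain ⟨φ₀, hφ₀⟩ := hS
  obtain ⟨x₀, hx₀⟩ := hX
  have hbdd : BddAbove {z : ℝ | ∃ x ∈ X, z = |b x|} := ⟨C, by rintro z ⟨x, hx, rfl⟩; exact hb x hx⟩
  have hbF : BddAbove {z : ℝ | ∃ φ ∈ S, ∃ x ∈ X, z = |F φ x|} := by
    refine ⟨C + δ, ?_⟩
    rintro z ⟨φ, hφ, x, hx, rfl⟩
    linarith [abs_sub_abs_le_abs_sub (F φ x) (b x), hF φ hφ x hx, hb x hx]
  refine ⟨hbF, abs_sub_le_iff.2 ⟨?_, ?_⟩⟩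
  · rw [sub_le_iff_le_add']
    refine csSup_le ⟨_, φ₀, hφ₀, x₀, hx₀, rfl⟩ ?_
    rintro z ⟨φ, hφ, x, hx, rfl⟩
    linarith [abs_sub_abs_le_abs_sub (F φ x) (b x), hF φ hφ x hx,
      le_csSup hbdd ⟨x, hx, rfl⟩]
  · rw [sub_le_iff_le_add']
    refine csSup_le ⟨_, x₀, hx₀, rfl⟩ ?_
    rintro z ⟨x, hx, rfl⟩
    linarith [abs_sub_abs_le_abs_sub (b x) (F φ₀ x), abs_sub_comm (b x) (F φ₀ x),
      hF φ₀ hφ₀ x hx, le_csSup hbF ⟨φ₀, hφ₀, x, hx, rfl⟩]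

theorem corollary1 {Ω : Type*} [MeasurableSpace Ω] (P : Measure Ω) [IsProbabilityMeasure P]
    (K g : ℝ → ℝ) (h : ℕ → ℝ) (s β c φbar : ℝ)
    (e : ℕ → ℕ → Ω → ℝ) (V0 : ℕ → ℝ → Ω → ℝ)
    (hs : 2 < s) (hc : 0 < c) (hφ_pos : 0 < φbar) (hφ_lt : φbar < 1)
    -- the kernel and the trend
    (hK : KernelRegular K) (hK_pos : KernelPositive K)
    (hg : ContDiffOn ℝ 2 g (Icc 0 1))
    -- the bandwidth, with parameter dimension `m = 1`
    (h_pos : ∀ T, 1 ≤ T → 0 < h T)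
    (h_zero : Tendsto h atTop (𝓝 0))
    (h_Th : Tendsto (fun T : ℕ => (T : ℝ) * h T) atTop atTop)
    (hβ : (1 * (s - 1) * (1 + 2 * c) + 2 * s - 1) / (s - 2) < β)
    (h_band : Tendsto
      (fun T : ℕ => Real.log T / ((T : ℝ) ^ bandwidthExponent β s 1 c * h T)) atTop (𝓝 0))
    -- the autoregression
    (he : ErrorAssumptions P s e)
    (hV0 : InitialAssumptions P s φbar h e V0) :
    -- the estimator is well defined for all large `T`
    (∀ᶠ T in atTop, ∀ x ∈ Icc (0 : ℝ) 1, IsUnit (localLinearS K (h T) T x).det) ∧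
    -- the supremum over `φ` and `x` is `O(h²)` (deterministic) plus `O_p(√(ln T / (T h)))`
    ∃ (A : ℕ → ℝ) (R : ℕ → Ω → ℝ),
      (∀ᶠ T in atTop, ∀ᵐ ω ∂P,
        IsLUB {z : ℝ | ∃ φ ∈ Icc (-φbar) φbar, ∃ x ∈ Icc (0 : ℝ) 1,
          z = |localLinearEstimator K (h T) T (observations g V0 e T φ ω) x - g x|}
          (A T + R T ω)) ∧
      A =O[atTop] (fun T => h T ^ 2) ∧
      IsBigOInProbability P R (fun T => Real.sqrt (Real.log T / ((T : ℝ) * h T))) := by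
  obtain ⟨c₀, N₀, hc₀, hdet⟩ := hK.exists_det_ge hK_pos
  obtain ⟨S₀, hS₀, hSb⟩ := hK.exists_abs_localLinearS_le
  obtain ⟨Cb, N₁, hCb, hbias⟩ := exists_bias_le hK hK_pos hg
  choose B Λ L H using hK.exists_isLipschitzBump
  obtain ⟨Ce, hCe⟩ := he.moment
  obtain ⟨Cv, hCv⟩ := hV0.moment
  have hmom : ∀ T, ∀ t ∈ Finset.Icc 1 T,
      ∫⁻ ω, ENNReal.ofReal (|e T t ω| ^ s) ∂P ≤ ENNReal.ofReal (max Ce 0) := fun T t ht =>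
    (hCe T t ht).trans (ENNReal.ofReal_le_ofReal (le_max_left _ _))
  have hCe0 : 0 ≤ max Ce 0 := le_max_right _ _
  have hr := one_lt_mul_one_sub_bandwidthExponent hs hc hβ
  have hd : 0 < 1 - φbar := by linarith
  have hs0 : 0 < s := by linarith
  have hh2 : ∀ᶠ T in atTop, h T ≤ 1 / 2 := h_zero.eventually_le_const (by norm_num)
  have hTh : ∀ a : ℝ, ∀ᶠ T : ℕ in atTop, a ≤ T * h T := fun a => h_Th.eventually_ge_atTop a
  set X : Set ℝ := Icc (0 : ℝ) 1 with hX
  set Φ : Set ℝ := Icc (-φbar) φbar with hΦ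
  have hXne : X.Nonempty := ⟨0, by simp [hX]⟩
  have hΦne : Φ.Nonempty := ⟨0, by simp [hΦ, hφ_pos.le]⟩
  -- the deterministic bias and the stochastic part of the estimation error
  set bias : ℕ → ℝ → ℝ := fun T x =>
    localLinearEstimator K (h T) T (fun t => g ((t : ℝ) / T)) x - g x with hbias_def
  set F : ℕ → Ω → ℝ → ℝ → ℝ := fun T ω φ x =>
    localLinearEstimator K (h T) T (observations g V0 e T φ ω) x - g x with hF_def
  set W : ℕ → Ω → ℝ → ℕ → ℝ := fun T ω φ =>
    arProcess φ (V0 T φ ω) (fun k => e T k ω) with hW_def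
  have hsplit : ∀ T ω φ x, F T ω φ x - bias T x = localLinearEstimator K (h T) T (W T ω φ) x := by
    intro T ω φ x
    have := localLinearEstimator_add K (h T) T (fun t => g ((t : ℝ) / T)) (W T ω φ) x
    simp only [hF_def, hbias_def]
    rw [show observations g V0 e T φ ω = fun t : ℕ => g ((t : ℝ) / T) + W T ω φ t from rfl, this]
    ring
  -- uniform bound of the stochastic part through the weighted sums of the errors
  set Q : ℕ → ℝ := fun i => (Λ i * (2 * (L i + 1) + 1) + 2 * B i) * (1 + (1 - φbar)⁻¹) with hQ
  have hstoch : ∀ (T : ℕ) (ω : Ω) (m : ℝ) (E : ℕ → ℝ), 1 ≤ T → h T ≤ 1 / 2 → N₀ ≤ T * h T →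
      1 ≤ T * h T → 0 ≤ m → (∀ t ∈ Finset.Icc 1 T, |e T t ω| ≤ m) →
      (∀ φ ∈ Φ, |V0 T φ ω| ≤ m) →
      (∀ i < 2, ∀ x ∈ X, |∑ t ∈ Finset.Icc 1 T,
        designWeight (fun u => K u * u ^ i) (h T) T x t * e T t ω| ≤ E i) →
      ∀ φ ∈ Φ, ∀ x ∈ X, |F T ω φ x - bias T x| ≤ S₀ / c₀ * ((1 - φbar)⁻¹ *
        ((E 0 + Q 0 * (m / (T * h T))) + (E 1 + Q 1 * (m / (T * h T))))) := by
    intro T ω m E hT hhT hN hn hm hem hvm hE φ hφ x hx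
    have hh := h_pos T hT
    rw [hsplit]
    refine (abs_localLinearEstimator_le _ hc₀ (hdet T (h T) x hT hh hhT hN hx)
      (hSb T (h T) x hT hh hn)).trans ?_
    rw [mul_add (1 - φbar)⁻¹]
    have hD : ∀ i : Fin 2, |localLinearD K (h T) T (W T ω φ) x i| ≤
        (1 - φbar)⁻¹ * (E i + Q i * (m / (T * h T))) := by
      intro i
      rw [localLinearD_apply]
      refine ((H i).abs_sum_autoregression_le hT hh hn _ (abs_le.2 hφ) hφ_lt hm hem (hvm φ hφ) x).trans ?_
      have := hE i i.isLt x hx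
      gcongr
    exact mul_le_mul_of_nonneg_left (add_le_add (hD 0) (hD 1)) (by positivity)
  have hlarge : ∀ᶠ T : ℕ in atTop, 1 ≤ T ∧ h T ≤ 1 / 2 ∧ N₀ ≤ T * h T ∧ N₁ ≤ T * h T ∧
      1 ≤ T * h T := by
    filter_upwards [eventually_ge_atTop 1, hh2, hTh N₀, hTh N₁, hTh 1] with T a b c d e
    exact ⟨a, b, c, d, e⟩
  have hbias' : ∀ᶠ T : ℕ in atTop, ∀ x ∈ X, |bias T x| ≤ Cb * h T ^ 2 := by
    filter_upwards [hlarge] with T hT x hx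
    exact hbias T (h T) x hT.1 (h_pos T hT.1) hT.2.1 hT.2.2.2.2 hT.2.2.2.1 hx
  refine ⟨?_, fun T => sSup {z | ∃ x ∈ X, z = |bias T x|},
    fun T ω => sSup {z | ∃ φ ∈ Φ, ∃ x ∈ X, z = |F T ω φ x|} - sSup {z | ∃ x ∈ X, z = |bias T x|},
    ?_, ?_, ?_⟩
  · filter_upwards [hlarge] with T hT x hx
    exact isUnit_iff_ne_zero.2
      (hc₀.trans_le (hdet T (h T) x hT.1 (h_pos T hT.1) hT.2.1 hT.2.2.1 hx)).ne'
  · filter_upwards [hlarge, hbias'] with T hT hbT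
    have hh := h_pos T hT.1
    filter_upwards [(hV0.measure_sup hs0 hT.1 hh (hCv T hT.1)).2] with ω ⟨v, hv⟩
    rw [add_sub_cancel]
    refine isLUB_csSup ?_ ?_
    · obtain ⟨φ, hφ⟩ := hΦne
      obtain ⟨x, hx⟩ := hXne
      exact ⟨_, φ, hφ, x, hx, rfl⟩
    · set m := |v| + ∑ t ∈ Finset.Icc 1 T, |e T t ω|
      have hm0 : 0 ≤ ∑ t ∈ Finset.Icc 1 T, |e T t ω| := Finset.sum_nonneg fun _ _ => abs_nonneg _
      have hem : ∀ t ∈ Finset.Icc 1 T, |e T t ω| ≤ m := fun t ht => by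
        have := Finset.single_le_sum (f := fun t => |e T t ω|) (fun _ _ => abs_nonneg _) ht
        linarith [abs_nonneg v]
      refine (abs_sSup_sub_sSup_le hΦne hXne hbT (hstoch T ω m
        (fun i => B i * (2 * L i + 1) * m) hT.1 hT.2.1 hT.2.2.1 hT.2.2.2.2 (by positivity) hem
        (fun φ hφ => by linarith [hv φ hφ, le_abs_self v]) fun i _ x _ => ?_)).1
      refine (Finset.abs_sum_le_sum_abs _ _).trans ?_
      calc _ ≤ ∑ t ∈ Finset.Icc 1 T,
            |designWeight (fun u => K u * u ^ i) (h T) T x t| * m := by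
            refine Finset.sum_le_sum fun t ht => ?_
            rw [abs_mul]
            exact mul_le_mul_of_nonneg_left (hem t ht) (abs_nonneg _)
        _ ≤ _ := by
            rw [← Finset.sum_mul]
            exact mul_le_mul_of_nonneg_right
              ((H i).sum_abs_designWeight_le hT.1 hh hT.2.2.2.2 x) (by positivity)
  · refine Asymptotics.IsBigO.of_bound Cb ?_
    filter_upwards [hbias'] with T hbT
    rw [Real.norm_eq_abs, Real.norm_eq_abs, abs_of_nonneg (sq_nonneg (h T)), abs_of_nonneg]
    · refine csSup_le ?_ ?_
      · obtain ⟨x, hx⟩ := hXne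
        exact ⟨_, x, hx, rfl⟩
      · rintro z ⟨x, hx, rfl⟩
        exact hbT x hx
    · refine Real.sSup_nonneg ?_
      rintro z ⟨x, _, rfl⟩
      exact abs_nonneg _
  · set τ := truncationLevel β s c with hτ_def
    set G : ℕ → ℝ := fun i =>
      max Ce 0 * (B i * (2 * L i + 1)) + B i ^ 2 * (2 * L i + 1) + 5 + Λ i with hG
    have hG0 : ∀ i, 0 ≤ G i := fun i => by
      have := (H i).B_nonneg
      have := (H i).L_nonneg
      have := (H i).Λ_nonneg
      positivity
    have hQ0 : ∀ i, 0 ≤ Q i := fun i => by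
      have := (H i).B_nonneg
      have := (H i).L_nonneg
      have := (H i).Λ_nonneg
      positivity
    intro ε hε
    refine ⟨S₀ / c₀ * ((1 - φbar)⁻¹ * ((G 0 + Q 0) + (G 1 + Q 1))) + 1, ?_, ?_⟩
    · have := hG0 0; have := hG0 1; have := hQ0 0; have := hQ0 1
      positivity
    -- the exceptional probabilities vanish
    have hprob : Tendsto (fun T : ℕ => 4 / (T : ℝ) + 4 / (T : ℝ) +
        max Ce 0 * (T / τ T ^ s) + max Cv 0 * (T / τ T ^ s)) atTop (𝓝 0) := by
      have h1 := tendsto_div_truncationLevel_rpow hr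
      have h2 := tendsto_const_div_atTop_nhds_zero_nat (4 : ℝ)
      simpa using ((h2.add h2).add (h1.const_mul (max Ce 0))).add (h1.const_mul (max Cv 0))
    have hband : ∀ δ : ℝ, 0 < δ →
        ∀ᶠ T : ℕ in atTop, τ T ^ 2 * Real.log T / (T * h T) ≤ δ := by
      intro δ hδ
      filter_upwards [h_band.eventually_le_const hδ, eventually_ge_atTop 1] with T h1 h2
      rw [hτ_def, truncationLevel_sq_mul _ h2]
      exact h1
    have hbandB : ∀ i, ∀ᶠ T : ℕ in atTop,
        B i ^ 2 * (τ T ^ 2 * Real.log T / (T * h T)) ≤ 1 := by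
      intro i
      filter_upwards [hband (1 / (B i ^ 2 + 1)) (by positivity)] with T hT
      calc _ ≤ B i ^ 2 * (1 / (B i ^ 2 + 1)) := by gcongr
        _ ≤ 1 := by
          rw [mul_one_div, div_le_one (by positivity)]
          linarith
    have hlog : ∀ᶠ T : ℕ in atTop, 1 ≤ Real.log T :=
      (Real.tendsto_log_atTop.comp tendsto_natCast_atTop_atTop).eventually_ge_atTop 1
    filter_upwards [hlarge, hbias', hband 1 one_pos, hbandB 0, hbandB 1, hlog,
      hprob.eventually_le_const hε] with T hT hbT hb1 hB0 hB1 hlT hpT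
    obtain ⟨hT1, hhT, hN, -, hn⟩ := hT
    have hh := h_pos T hT1
    have hp : (0 : ℝ) < T * h T := by linarith
    have hτ1 : 1 ≤ τ T := one_le_truncationLevel hs hr hT1
    have hτ0 : 0 < τ T := by linarith
    have hTτ : (T : ℝ) ≤ τ T ^ s := le_truncationLevel_rpow hr hT1
    have hT1' : (1 : ℝ) ≤ T := by exact_mod_cast hT1
    have hτs : 0 < τ T ^ s := by linarith
    set b := √(Real.log T / (T * h T)) with hb
    have hb0 : 0 < b := Real.sqrt_pos.2 (div_pos (by linarith) hp)
    have hτb : τ T / (T * h T) ≤ b := div_le_sqrt_div hlT hp hb1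
    set bad : ℕ → Set Ω := fun i => {ω | ∃ x ∈ X, G i * b <
      |∑ t ∈ Finset.Icc 1 T, designWeight (fun u => K u * u ^ i) (h T) T x t *
        truncation (e T t) (τ T) ω|} with hbad
    set badE : Set Ω := {ω | ∃ t ∈ Finset.Icc 1 T, τ T ≤ |e T t ω|} with hbadE
    set badV : Set Ω := {ω | ∃ φ ∈ Φ, τ T < |V0 T φ ω|} with hbadV
    have pbad : ∀ i, B i ^ 2 * (τ T ^ 2 * Real.log T / (T * h T)) ≤ 1 →
        P (bad i) ≤ ENNReal.ofReal (4 / T) := fun i hBi =>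
      measure_exists_abs_sum_truncation_gt_le hs hCe0 he hmom (H i) hT1 hh (by linarith) hn hτ1
        hlT hTτ hBi hb1
    have pbadE : P badE ≤ ENNReal.ofReal (max Ce 0 * (T / τ T ^ s)) :=
      measure_exists_abs_error_ge_le hs0 hτ0 (he.measurable T) (hmom T)
    have pbadV : P badV ≤ ENNReal.ofReal (max Cv 0 * (T / τ T ^ s)) := by
      refine ((hV0.measure_sup hs0 hT1 hh (hCv T hT1)).1 (τ T) hτ0).trans
        (ENNReal.ofReal_le_ofReal ?_)
      rw [div_eq_mul_one_div]
      gcongr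
      exact le_max_left _ _
    have hsub : {ω | (S₀ / c₀ * ((1 - φbar)⁻¹ * ((G 0 + Q 0) + (G 1 + Q 1))) + 1) * b <
        |sSup {z | ∃ φ ∈ Φ, ∃ x ∈ X, z = |F T ω φ x|} - sSup {z | ∃ x ∈ X, z = |bias T x|}|} ⊆
        bad 0 ∪ bad 1 ∪ badE ∪ badV := by
      intro ω hω
      by_contra hgood
      simp only [mem_union, not_or] at hgood
      obtain ⟨⟨⟨g0, g1⟩, gE⟩, gV⟩ := hgood
      simp only [hbad, hbadE, hbadV, mem_ofPred_eq, not_exists, not_and, not_lt, not_le]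
        at g0 g1 gE gV
      have htr : ∀ i x, ∑ t ∈ Finset.Icc 1 T, designWeight (fun u => K u * u ^ i) (h T) T x t *
          truncation (e T t) (τ T) ω = ∑ t ∈ Finset.Icc 1 T,
          designWeight (fun u => K u * u ^ i) (h T) T x t * e T t ω := fun i x =>
        Finset.sum_congr rfl fun t ht => by rw [truncation_eq_self (gE t ht)]
      have key := (abs_sSup_sub_sSup_le hΦne hXne hbT (hstoch T ω (τ T) (fun i => G i * b) hT1 hhT
        hN hn hτ0.le (fun t ht => (gE t ht).le) gV fun i hi x hx => by
          interval_cases i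
          · rw [← htr]; exact g0 x hx
          · rw [← htr]; exact g1 x hx)).2
      refine absurd hω (not_lt.2 (key.trans ?_))
      have q0 := hQ0 0
      have q1 := hQ0 1
      calc _ ≤ S₀ / c₀ * ((1 - φbar)⁻¹ * ((G 0 * b + Q 0 * b) + (G 1 * b + Q 1 * b))) := by
            gcongr
        _ ≤ S₀ / c₀ * ((1 - φbar)⁻¹ * ((G 0 * b + Q 0 * b) + (G 1 * b + Q 1 * b))) + b := by
            linarith
        _ = _ := by ring
    have n1 : 0 ≤ 4 / (T : ℝ) := by positivity
    have n2 : 0 ≤ (T : ℝ) / τ T ^ s := by positivity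
    have n3 : 0 ≤ max Ce 0 * ((T : ℝ) / τ T ^ s) := mul_nonneg hCe0 n2
    have n4 : 0 ≤ max Cv 0 * ((T : ℝ) / τ T ^ s) := mul_nonneg (le_max_right _ _) n2
    calc _ ≤ P (bad 0 ∪ bad 1 ∪ badE ∪ badV) := measure_mono hsub
      _ ≤ P (bad 0) + P (bad 1) + P badE + P badV :=
          (measure_union_le _ _).trans (by
            gcongr
            exact (measure_union_le _ _).trans (by gcongr; exact measure_union_le _ _))
      _ ≤ ENNReal.ofReal (4 / T) + ENNReal.ofReal (4 / T) +
          ENNReal.ofReal (max Ce 0 * (T / τ T ^ s)) +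
          ENNReal.ofReal (max Cv 0 * (T / τ T ^ s)) := by
          gcongr
          · exact pbad 0 hB0
          · exact pbad 1 hB1
      _ ≤ ENNReal.ofReal ε := by
          rw [← ENNReal.ofReal_add n1 n1, ← ENNReal.ofReal_add (by linarith) n3,
            ← ENNReal.ofReal_add (by linarith) n4]
          exact ENNReal.ofReal_le_ofReal hpT
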